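/- Conventions. Let $d\ge 1$, let $\|\cdot\|$ be the Euclidean norm on $\mathbb R^d$, $rB_2=\{x\in\mathbb R^d:\|x\|\le r\}$, $B_2 = 1B_2$, and $\mathbb N=\{1,2,\dots\}$. For integrable $f$ put $\widehat f(\xi)=(2\pi)^{-d/2}\int_{\mathbb R^d}f(x)e^{-i\langle\xi,x\rangle}\,dx$, and let $\mathcal F$ be the extension of this transform to a unitary operator of $L_2(\mathbb R^d)$. For a bounded measurable set $S\subset\mathbb R^d$ of positive measure let $PW_S=\{f\in L_2(\mathbb R^d):\mathcal F[f]=0\text{ a.e. outside }S\}$; each $f\in PW_S$ is identified with its continuous representative. A symmetric convex body is a compact convex set $Z\subset\mathbb R^d$ with $Z=-Z$ that contains a ball of positive radius about $0$. A sequence $(e_j)_{j\in\mathbb N}$ in a Hilbert space $H$ is a Riesz basis if every $h\in H$ has a unique expansion $h=\sum_j a_je_j$ with $(a_j)\in\ell_2$ and if for some $R>0$ and all $(c_j)\in\ell_2$ the series $\sum_jc_je_j$ converges and $R^{-1}\|(c_j)\|_{\ell_2}\le\|\sum_jc_je_j\|\le R\|(c_j)\|_{\ell_2}$. A sequence $X=(x_j)_{j\in\mathbb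 N}$ in $\mathbb R^d$ is a Riesz-basis sequence for $L_2(Z)$ if $(e^{-i\langle x_j,\cdot\rangle})_{j\in\mathbb N}$ is a Riesz basis of $L_2(Z)$. Interpolators. A function $\phi:\mathbb R^d\to\mathbb R$ is a $d$-dimensional interpolator for $PW_Z$ if (I1) $\phi\in L_1\cap C(\mathbb R^d)$ and $\widehat\phi\in L_1$; (I2) $\widehat\phi\ge0$, and $\widehat\phi\ge\varepsilon$ on $Z$ for some $\varepsilon>0$; (I3) $\sum_{j\ge1}2^{jd/2}M_j<\infty$, where $M_j=\sup_{u\in Z\setminus\frac12Z}|\widehat\phi(2^ju)|$. Let $0<\delta<1$, $\delta B_2\subset Z\subset B_2$ and $\beta>0$. A family $(\phi_\alpha)_{\alpha\in A}$ of $d$-dimensional interpolators for $PW_Z$, with $A\subset(0,\infty)$ unbounded, is regular for $PW_{\beta B_2}$ if, with $M_j(\alpha)$ denoting $M_j$ for $\phi=\phi_\alpha$, $S_\alpha=\sum_{j\ge1}2^{jd/2}M_j(\alpha)$, $M_\alpha=\sup_{B_2\setminus\delta B_2}|\widehat{\phi_\alpha}|$, $m_\alpha(\beta)=\inf_{\beta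 B_2}|\widehat{\phi_\alpha}|$ and $\gamma_\alpha=\inf_{B_2}|\widehat{\phi_\alpha}|$: (R1) there is a constant $C$ with $S_\alpha\le CM_\alpha$ for all sufficiently large $\alpha\in A$; (R2) $M_\alpha^3/(m_\alpha(\beta)\gamma_\alpha^2)\to0$ as $\alpha\to\infty$ in $A$. Theorem. Let $d\ge1$, $\delta\in(\sqrt{2/3},1)$ and $\beta\in(0,\sqrt{3\delta^2-2})$, and let $Z\subset\mathbb R^d$ be a symmetric convex body with $\delta B_2\subset Z\subset B_2$. Put $g_\alpha(x)=e^{-\|x\|^2/(4\alpha)}$. Then $(g_\alpha)_{\alpha\in[1,\infty)}$ is a family of $d$-dimensional interpolators for $PW_Z$ that is regular for $PW_{\beta B_2}$. Let moreover $X=(x_j)_{j\in\mathbb N}$ be a Riesz-basis sequence for $L_2(Z)$. Then for all $\alpha\ge1$ and $f\in PW_Z$ there is a unique sequence $(a_j)\in\ell_2$ with $\sum_ja_jg_\alpha(x_k-x_j)=f(x_k)$ for all $k\in\mathbb N$, and $\mathcal I_\alpha f=\sum_ja_jg_\alpha(\cdot-x_j)$ converges pointwise on $\mathbb R^d$ to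 a function in $L_2(\mathbb R^d)$. For every $f\in PW_{\beta B_2}$, $\mathcal I_\alpha f\to f$ as $\alpha\to\infty$, both in $L_2(\mathbb R^d)$ and uniformly on $\mathbb R^d$. Moreover, there is a constant $C>0$, independent of $f$ and $\alpha$, such that for all $f\in PW_{\beta B_2}$ and all $\alpha\ge1$ $$\max\left\{\|\mathcal I_\alpha f-f\|_{L_2(\mathbb R^d)},\ \|\mathcal I_\alpha f-f\|_{L_\infty(\mathbb R^d)}\right\}\le C\,e^{\alpha(\beta^2+2-3\delta^2)}\,\|f\|_{L_2(\mathbb R^d)}.$$ -/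

import Mathlib

open MeasureTheory Filter Topology Set
open scoped ENNReal NNReal Pointwise

noncomputable section

namespace BandInterp

/-- The Fourier transform of an integrable function in the unitary, angular-frequency convention,
`(2π)^(-d/2) ∫ f(x) exp(-i⟨ξ, x⟩) dx`. -/
def fourierL1 {d : ℕ} (f : EuclideanSpace ℝ (Fin d) → ℂ) (ξ : EuclideanSpace ℝ (Fin d)) : ℂ :=
  (((2 * Real.pi) ^ (-(d : ℝ) / 2) : ℝ) : ℂ) *
    ∫ x, f x * Complex.exp (-(Complex.I * ((inner ℝ ξ x : ℝ) : ℂ)))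

/-- The Fourier transform of an element of `L₂(ℝ^d)` in the same convention, as a function defined
almost everywhere. Mathlib's transform uses the kernel `exp(-2πi⟨ξ, x⟩)`, whence the rescaling. -/
def fourierL2 {d : ℕ} (f : Lp (α := EuclideanSpace ℝ (Fin d)) ℂ 2)
    (ξ : EuclideanSpace ℝ (Fin d)) : ℂ :=
  (((2 * Real.pi) ^ (-(d : ℝ) / 2) : ℝ) : ℂ) *
    (FourierTransform.fourier f : Lp (α := EuclideanSpace ℝ (Fin d)) ℂ 2) ((2 * Real.pi)⁻¹ • ξ)

/-- The Paley-Wiener space `PW_S`. Its elements are given by their continuous representatives: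
each class in `L₂(ℝ^d)` with Fourier transform supported in a bounded set `S` has exactly one. -/
def paleyWiener {d : ℕ} (S : Set (EuclideanSpace ℝ (Fin d))) :
    Set (EuclideanSpace ℝ (Fin d) → ℂ) :=
  {f | Continuous f ∧ ∃ hf : MemLp f 2 volume, ∀ᵐ ξ, ξ ∉ S → fourierL2 (hf.toLp f) ξ = 0}

/-- Symmetric convex bodies in `ℝ^d`. -/
structure IsSymmetricConvexBody {d : ℕ} (Z : Set (EuclideanSpace ℝ (Fin d))) : Prop where
  isCompact : IsCompact Z
  convex : Convex ℝ Z
  neg_mem : ∀ z ∈ Z, -z ∈ Z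
  contains_ball : ∃ r > 0, Metric.closedBall 0 r ⊆ Z

/-- Riesz bases of a Hilbert space: unique `ℓ₂`-expansions, and two-sided bounds with a basis
constant `R`. -/
def IsRieszBasis {H : Type*} [NormedAddCommGroup H] [InnerProductSpace ℂ H] (e : ℕ → H) : Prop :=
  (∀ h : H, ∃! a : lp (fun _ : ℕ => ℂ) 2, HasSum (fun j => a j • e j) h) ∧
  ∃ R : ℝ, 0 < R ∧ ∀ c : lp (fun _ : ℕ => ℂ) 2, Summable (fun j => c j • e j) ∧
    R⁻¹ * ‖c‖ ≤ ‖∑' j, c j • e j‖ ∧ ‖∑' j, c j • e j‖ ≤ R * ‖c‖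

/-- `x` is a Riesz-basis sequence for `L₂(Z)`: the classes in `L₂(Z)` of the exponentials
`exp(-i⟨x_j, ·⟩)` form a Riesz basis of `L₂(Z)`. -/
def IsRieszBasisSequence {d : ℕ} (Z : Set (EuclideanSpace ℝ (Fin d)))
    (x : ℕ → EuclideanSpace ℝ (Fin d)) : Prop :=
  ∃ e : ℕ → Lp ℂ 2 (volume.restrict Z),
    (∀ j, e j =ᵐ[volume.restrict Z]
      fun ξ => Complex.exp (-(Complex.I * ((inner ℝ (x j) ξ : ℝ) : ℂ)))) ∧
    IsRieszBasis e

/-- The Fourier transform of a real-valued function. -/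
def hat {d : ℕ} (φ : EuclideanSpace ℝ (Fin d) → ℝ) : EuclideanSpace ℝ (Fin d) → ℂ :=
  fourierL1 (fun x => (φ x : ℂ))

/-- `M_j`, the supremum over `u ∈ Z ∖ ½Z` of `|φ̂(2^j u)|`. -/
def dyadicSup {d : ℕ} (Z : Set (EuclideanSpace ℝ (Fin d))) (φ : EuclideanSpace ℝ (Fin d) → ℝ)
    (j : ℕ) : ℝ≥0∞ :=
  ⨆ u ∈ Z \ ((1 / 2 : ℝ) • Z), ‖hat φ ((2 : ℝ) ^ j • u)‖ₑ

/-- `S = ∑_{j ≥ 1} 2^(jd/2) M_j`. -/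
def dyadicSum {d : ℕ} (Z : Set (EuclideanSpace ℝ (Fin d))) (φ : EuclideanSpace ℝ (Fin d) → ℝ) :
    ℝ≥0∞ :=
  ∑' j : ℕ, (2 : ℝ≥0∞) ^ (((j + 1 : ℕ) : ℝ) * (d : ℝ) / 2) * dyadicSup Z φ (j + 1)

/-- `d`-dimensional interpolators for `PW_Z`. -/
structure IsInterpolator {d : ℕ} (Z : Set (EuclideanSpace ℝ (Fin d)))
    (φ : EuclideanSpace ℝ (Fin d) → ℝ) : Prop where
  integrable : Integrable φ
  continuous : Continuous φ
  integrable_hat : Integrable (hat φ)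
  hat_nonneg : ∀ ξ, (hat φ ξ).im = 0 ∧ 0 ≤ (hat φ ξ).re
  hat_pos : ∃ ε : ℝ, 0 < ε ∧ ∀ ξ ∈ Z, ε ≤ (hat φ ξ).re
  dyadicSum_lt_top : dyadicSum Z φ < ⊤

/-- The supremum of `|φ̂|` over `B₂ ∖ δB₂`. -/
def annulusSup {d : ℕ} (δ : ℝ) (φ : EuclideanSpace ℝ (Fin d) → ℝ) : ℝ≥0∞ :=
  ⨆ u ∈ Metric.closedBall (0 : EuclideanSpace ℝ (Fin d)) 1 \ Metric.closedBall 0 δ, ‖hat φ u‖ₑ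

/-- The infimum of `|φ̂|` over `rB₂`. -/
def ballInf {d : ℕ} (r : ℝ) (φ : EuclideanSpace ℝ (Fin d) → ℝ) : ℝ≥0∞ :=
  ⨅ u ∈ Metric.closedBall (0 : EuclideanSpace ℝ (Fin d)) r, ‖hat φ u‖ₑ

/-- Families `(φ_α)_{α ∈ A}` of `d`-dimensional interpolators for `PW_Z`, `δB₂ ⊆ Z ⊆ B₂`, that are
regular for `PW_{βB₂}`. Limits are taken as `α → ∞` in `A`. -/
structure IsRegularFamily {d : ℕ} (Z : Set (EuclideanSpace ℝ (Fin d))) (δ β : ℝ) (A : Set ℝ)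
    (φ : ℝ → EuclideanSpace ℝ (Fin d) → ℝ) : Prop where
  index_pos : A ⊆ Ioi 0
  index_unbounded : ¬ BddAbove A
  interpolator : ∀ α ∈ A, IsInterpolator Z (φ α)
  sum_le : ∃ C : ℝ≥0, ∀ᶠ α in atTop ⊓ 𝓟 A, dyadicSum Z (φ α) ≤ C * annulusSup δ (φ α)
  ratio_tendsto : Tendsto
    (fun α => annulusSup δ (φ α) ^ 3 / (ballInf β (φ α) * ballInf 1 (φ α) ^ 2))
    (atTop ⊓ 𝓟 A) (𝓝 0)

/-- `a ∈ ℓ₂` solves the interpolation equations `∑_j a_j φ(x_k - x_j) = f(x_k)`, `k ∈ ℕ`. -/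
def SolvesInterpolation {d : ℕ} (φ : EuclideanSpace ℝ (Fin d) → ℝ)
    (x : ℕ → EuclideanSpace ℝ (Fin d)) (f : EuclideanSpace ℝ (Fin d) → ℂ)
    (a : lp (fun _ : ℕ => ℂ) 2) : Prop :=
  ∀ k, HasSum (fun j => a j * (φ (x k - x j) : ℂ)) (f (x k))

/-- The solution of the interpolation equations (meaningful when there is exactly one). -/
def interpolationCoeff {d : ℕ} (φ : EuclideanSpace ℝ (Fin d) → ℝ)
    (x : ℕ → EuclideanSpace ℝ (Fin d)) (f : EuclideanSpace ℝ (Fin d) → ℂ) :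
    lp (fun _ : ℕ => ℂ) 2 :=
  Classical.epsilon (SolvesInterpolation φ x f)

/-- The interpolation operator, `f ↦ ∑_j a_j φ(· - x_j)`. -/
def interpolant {d : ℕ} (φ : EuclideanSpace ℝ (Fin d) → ℝ)
    (x : ℕ → EuclideanSpace ℝ (Fin d)) (f : EuclideanSpace ℝ (Fin d) → ℂ) :
    EuclideanSpace ℝ (Fin d) → ℂ :=
  fun t => ∑' j, interpolationCoeff φ x f j * (φ (t - x j) : ℂ)

/-- The Gaussian `exp(-‖x‖² / (4α))`. -/
def gaussian {d : ℕ} (α : ℝ) (x : EuclideanSpace ℝ (Fin d)) : ℝ :=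
  Real.exp (-(‖x‖ ^ 2 / (4 * α)))

end BandInterp

end

/-! On the Fourier side interpolation is a least squares problem. Up to a factor, the transform of
the Gaussian is `weight α`, that is `exp(-α‖ξ‖²)`. Put `T a = weight (α/2) · ∑ a_j exp(-i⟨x_j, ·⟩)`,
an operator from `ℓ₂` to `L₂(ℝ^d)`. Its Gram matrix is a multiple of `g_α(x_k - x_j)`
(`inner_weightedExpo`). If `h` is the transform of `f` and `q = weight (-α/2) · h`, then the
interpolation equations are the normal equations of minimising `‖T a - q‖`, up to a rescaling of `a`
(`solvesInterpolation_iff`). The interpolant is the inverse transform of `weight (α/2) · T a`, so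
the error is that of `weight (α/2) · r` with the residual `r = T a - q`.

Boundedness of `T` on the whole space comes from the Bessel inequality on a ball, averaged over
translates (`exists_weighted_bessel`). The lower Riesz bound on `Z` makes `T` bounded below, which
gives a unique solution. Since `T = weight ((α-1)/2) · Ψ` with `Ψ` independent of `α`, all constants
can be kept uniform.

For the rate, every target on `Z` is matched exactly there by some `Ψ b` of comparable norm, by the
Riesz basis property. Off `Z` one has `‖ξ‖ > δ`, so `T b` is damped there by `A = exp(-(α-1)δ²/2)`.
This is used twice. By minimality, a `b` with `T b = q` on `Z` gives `‖r‖ ≤ A R exp(αβ²) ‖h‖`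
(`norm_residual_le`). By orthogonality of `r` to the range of `T`, a `b` matching the error on `Z`
bounds that error by `A R ‖r‖` (`norm_cutoff_error_le`); off `Z` the factor `A` is immediate.
Altogether the error is `O(exp(α(β² - δ²)))`, which is at least as good as the claimed rate because
`2 - 3δ² ≥ -δ²` for `δ ≤ 1`. The uniform bound follows from the `L₁` norm of `weight (α/2) · r`,
estimated by Cauchy-Schwarz against `weight (1/2)`. Regularity of the family is a direct computation
with the explicit transform. -/

noncomputable section

namespace BandInterp

/-! ### Fourier inversion and Plancherel in the angular-frequency convention -/

section

open scoped FourierTransform ComplexConjugate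

variable {d : ℕ}

/-- The Hilbert space `L₂(ℝ^d)`. -/
abbrev L2Space (d : ℕ) := Lp ℂ 2 (volume : Measure (EuclideanSpace ℝ (Fin d)))

/-- The inverse Fourier integral in the unitary, angular-frequency convention. -/
def synth (u : EuclideanSpace ℝ (Fin d) → ℂ) (t : EuclideanSpace ℝ (Fin d)) : ℂ :=
  (((2 * Real.pi) ^ (-(d : ℝ) / 2) : ℝ) : ℂ) *
    ∫ ξ, Complex.exp (Complex.I * ((inner ℝ ξ t : ℝ) : ℂ)) * u ξ

theorem continuous_fourierInv {k : EuclideanSpace ℝ (Fin d) → ℂ} (hk : Integrable k) :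
    Continuous (𝓕⁻ k) :=
  VectorFourier.fourierIntegral_continuous (L := -innerₗ (EuclideanSpace ℝ (Fin d)))
    Real.continuous_fourierChar (continuous_inner (𝕜 := ℝ)).neg hk

/-- Fubini: the kernel of the inverse transform is symmetric in its two arguments. -/
theorem integral_fourierInv_smul_eq {f g : EuclideanSpace ℝ (Fin d) → ℂ} (hf : Integrable f)
    (hg : Integrable g) : ∫ x, 𝓕⁻ f x • g x = ∫ x, f x • 𝓕⁻ g x := by
  have hflip : (-innerₗ (EuclideanSpace ℝ (Fin d))).flip = -innerₗ (EuclideanSpace ℝ (Fin d)) := by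
    ext x y
    simp [real_inner_comm]
  have := VectorFourier.integral_fourierIntegral_smul_eq_flip (μ := volume) (ν := volume)
    (L := -innerₗ (EuclideanSpace ℝ (Fin d)))
    Real.continuous_fourierChar (continuous_inner (𝕜 := ℝ)).neg hf hg
  rw [hflip] at this
  exact this

/-- On `L₁ ∩ L₂` the inverse Fourier transform of `L₂` is given by the Fourier integral. -/
theorem fourierInv_Lp_ae_eq (k : L2Space d) (hk : Integrable k) :
    (𝓕⁻ k : L2Space d) =ᵐ[volume]
      𝓕⁻ (k : EuclideanSpace ℝ (Fin d) → ℂ) := by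
  -- Both sides are locally integrable, so they agree once they agree as distributions; there the
  -- `L₂` transform is defined by duality.
  refine ae_eq_of_integral_contDiff_smul_eq ((Lp.memLp _).locallyIntegrable (by norm_num))
    (continuous_fourierInv hk).locallyIntegrable fun g hg hgs => ?_
  have hs : ContDiff ℝ (⊤ : ℕ∞) (fun x => (g x : ℂ)) := Complex.ofRealCLM.contDiff.comp hg
  have hsupp : HasCompactSupport (fun x => (g x : ℂ)) :=
    hgs.comp_left (g := fun x : ℝ => (x : ℂ)) (by simp)
  set φ : SchwartzMap (EuclideanSpace ℝ (Fin d)) ℂ := hsupp.toSchwartzMap hs with hφ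
  have hφx : ∀ x, φ x = (g x : ℂ) := fun x => rfl
  have h1 := congrArg (fun T => T φ) (Lp.fourierInv_toTemperedDistribution_eq k)
  simp only [TemperedDistribution.fourierInv_apply, Lp.toTemperedDistribution_apply,
    SchwartzMap.fourierInv_coe] at h1
  rw [integral_fourierInv_smul_eq φ.integrable hk] at h1
  simp only [hφx] at h1
  simpa only [Complex.coe_smul] using h1.symm

/-- With `c = (2π)⁻¹` the factor is `(2π)^(d/2)`, which cancels the normalisation of `synth` and
`fourierL2`. -/
theorem eLpNorm_comp_smul_two (h : EuclideanSpace ℝ (Fin d) → ℂ) {c : ℝ} (hc : 0 < c) :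
    eLpNorm (fun x => h (c • x)) 2 volume =
      ENNReal.ofReal (c ^ (-(d : ℝ) / 2)) * eLpNorm h 2 volume := by
  have he : MeasurableEmbedding (fun x : EuclideanSpace ℝ (Fin d) => c • x) :=
    (Homeomorph.smulOfNeZero c hc.ne').measurableEmbedding
  have h1 := he.eLpNorm_map_measure (μ := volume) (g := h) (p := 2)
  rw [Measure.map_addHaar_smul _ hc.ne', eLpNorm_smul_measure_of_ne_top (by norm_num)] at h1
  change eLpNorm (h ∘ fun x => c • x) 2 volume = _
  rw [← h1, smul_eq_mul, ENNReal.ofReal_rpow_of_nonneg (abs_nonneg _) (by positivity)]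
  congr 2
  rw [abs_of_pos (by positivity), finrank_euclideanSpace_fin, ← Real.rpow_natCast,
    ← Real.rpow_neg hc.le, ← Real.rpow_mul hc.le]
  congr 1
  simp
  ring

theorem aestronglyMeasurable_comp_smul {h : EuclideanSpace ℝ (Fin d) → ℂ} {c : ℝ} (hc : 0 < c)
    (hh : AEStronglyMeasurable h volume) :
    AEStronglyMeasurable (fun x => h (c • x)) volume := by
  refine hh.comp_quasiMeasurePreserving ⟨measurable_const_smul c, ?_⟩
  rw [Measure.map_addHaar_smul _ hc.ne']
  exact Measure.smul_absolutelyContinuous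

theorem synth_eq_fourierInv (u : EuclideanSpace ℝ (Fin d) → ℂ) (t : EuclideanSpace ℝ (Fin d)) :
    synth u t = (((2 * Real.pi) ^ (-(d : ℝ) / 2) : ℝ) : ℂ) * 𝓕⁻ u ((2 * Real.pi)⁻¹ • t) := by
  rw [synth, Real.fourierInv_eq']
  congr 2
  funext ξ
  rw [inner_smul_right, smul_eq_mul, mul_comm Complex.I]
  congr 4
  field_simp

theorem continuous_synth {u : EuclideanSpace ℝ (Fin d) → ℂ} (hu : Integrable u) :
    Continuous (synth u) := by
  have : synth u = fun t => (((2 * Real.pi) ^ (-(d : ℝ) / 2) : ℝ) : ℂ) *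
      𝓕⁻ u ((2 * Real.pi)⁻¹ • t) := funext (synth_eq_fourierInv u)
  rw [this]
  exact continuous_const.mul ((continuous_fourierInv hu).comp (continuous_const_smul _))

/-- Plancherel's theorem for the inverse Fourier integral of a function in `L₁ ∩ L₂`. -/
theorem memLp_synth {u : EuclideanSpace ℝ (Fin d) → ℂ} (hu : Integrable u)
    (hu2 : MemLp u 2 volume) :
    MemLp (synth u) 2 volume ∧ eLpNorm (synth u) 2 volume = eLpNorm u 2 volume := by
  have hpi : 0 < (2 * Real.pi)⁻¹ := by positivity
  set k : L2Space d := MemLp.toLp (μ := volume) u hu2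
  have hk : (k : EuclideanSpace ℝ (Fin d) → ℂ) =ᵐ[volume] u := hu2.coeFn_toLp
  have h1 : (𝓕⁻ k : L2Space d) =ᵐ[volume] 𝓕⁻ u := by
    refine (fourierInv_Lp_ae_eq _ (hu.congr hk.symm)).trans (Eventually.of_forall fun x => ?_)
    exact Real.fourierInv_congr_ae hk x
  have hnorm : eLpNorm (synth u) 2 volume = eLpNorm u 2 volume := by
    have h2 : eLpNorm (𝓕⁻ u) 2 volume = eLpNorm u 2 volume := by
      have e1 := Lp.enorm_def (p := 2) (μ := volume) (𝓕⁻ k)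
      have e2 := Lp.enorm_def (p := 2) (μ := volume) k
      rw [← eLpNorm_congr_ae h1, ← eLpNorm_congr_ae hk, ← e1, ← e2, enorm_eq_iff_norm_eq,
        ← Lp.norm_fourier_eq (𝓕⁻ k), FourierTransform.fourier_fourierInv_eq]
    have : synth u = (((2 * Real.pi) ^ (-(d : ℝ) / 2) : ℝ) : ℂ) •
      fun t => 𝓕⁻ u ((2 * Real.pi)⁻¹ • t) := funext (synth_eq_fourierInv u)
    rw [this, eLpNorm_const_smul, eLpNorm_comp_smul_two _ hpi, h2, ← mul_assoc,
      ← ofReal_norm, ← ENNReal.ofReal_mul (norm_nonneg _), Complex.norm_real,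
      Real.norm_of_nonneg (by positivity), Real.inv_rpow (by positivity),
      mul_inv_cancel₀ (by positivity)]
    simp
  exact ⟨⟨(continuous_synth hu).aestronglyMeasurable, hnorm ▸ hu2.2⟩, hnorm⟩

/-- Functions in a Paley-Wiener space are the inverse Fourier integrals of their transforms. -/
theorem exists_eq_synth_of_mem_paleyWiener {S : Set (EuclideanSpace ℝ (Fin d))}
    (hS : Bornology.IsBounded S) {f : EuclideanSpace ℝ (Fin d) → ℂ} (hf : f ∈ paleyWiener S) :
    ∃ h : EuclideanSpace ℝ (Fin d) → ℂ, MemLp h 2 volume ∧ Integrable h ∧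
      eLpNorm h 2 volume = eLpNorm f 2 volume ∧ (∀ᵐ ξ, ξ ∉ S → h ξ = 0) ∧ f = synth h := by
  obtain ⟨hc, hf2, h0⟩ := hf
  have hpi : 0 < (2 * Real.pi)⁻¹ := by positivity
  set k : L2Space d := 𝓕 (hf2.toLp f) with hk
  set h := fourierL2 (hf2.toLp f) with hh
  have hdef : h = (((2 * Real.pi) ^ (-(d : ℝ) / 2) : ℝ) : ℂ) •
    fun ξ => k ((2 * Real.pi)⁻¹ • ξ) := rfl
  have hnorm : eLpNorm h 2 volume = eLpNorm f 2 volume := by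
    have h2 : eLpNorm k 2 volume = eLpNorm f 2 volume := by
      have e1 := Lp.enorm_def (p := 2) (μ := volume) k
      have e2 := Lp.enorm_def (p := 2) (μ := volume) (MemLp.toLp (μ := volume) f hf2)
      rw [← eLpNorm_congr_ae hf2.coeFn_toLp, ← e1, ← e2, enorm_eq_iff_norm_eq, hk, Lp.norm_fourier_eq]
    rw [hdef, eLpNorm_const_smul, eLpNorm_comp_smul_two _ hpi, h2, ← mul_assoc,
      ← ofReal_norm, ← ENNReal.ofReal_mul (norm_nonneg _), Complex.norm_real,
      Real.norm_of_nonneg (by positivity), Real.inv_rpow (by positivity),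
      mul_inv_cancel₀ (by positivity)]
    simp
  have hmeas : AEStronglyMeasurable h volume := by
    rw [hdef]
    exact (aestronglyMeasurable_comp_smul hpi (Lp.aestronglyMeasurable k)).const_smul _
  have hmem : MemLp h 2 volume := ⟨hmeas, hnorm ▸ hf2.2⟩
  -- On a bounded support, square integrability implies integrability.
  have hint : Integrable h := by
    obtain ⟨R, hR⟩ := hS.subset_closedBall 0
    have h1 : IntegrableOn h (Metric.closedBall 0 R) volume := by
      have : IsFiniteMeasure (volume.restrict (Metric.closedBall (0 : EuclideanSpace ℝ (Fin d)) R)) :=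
        ⟨by simpa using measure_closedBall_lt_top⟩
      exact (hmem.restrict _).integrable (by norm_num)
    refine h1.integrable_of_ae_notMem_eq_zero ?_
    filter_upwards [h0] with ξ hξ hn using hξ fun hs => hn (hR hs)
  refine ⟨h, hmem, hint, hnorm, h0, ?_⟩
  have hkint : Integrable k := by
    have hcne : (((2 * Real.pi) ^ (-(d : ℝ) / 2) : ℝ) : ℂ) ≠ 0 := by
      exact_mod_cast (by positivity : (0 : ℝ) < (2 * Real.pi) ^ (-(d : ℝ) / 2)).ne'
    have h1 : Integrable fun ξ => k ((2 * Real.pi)⁻¹ • ξ) := by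
      refine (integrable_smul_iff hcne _).1 ?_
      exact hint
    exact (integrable_comp_smul_iff volume _ hpi.ne').1 h1
  have hfk : f = 𝓕⁻ (k : EuclideanSpace ℝ (Fin d) → ℂ) := by
    refine (Continuous.ae_eq_iff_eq volume hc (continuous_fourierInv hkint)).1 ?_
    refine hf2.coeFn_toLp.symm.trans ?_
    have := fourierInv_Lp_ae_eq k hkint
    rwa [hk, FourierTransform.fourierInv_fourier_eq] at this
  funext t
  rw [synth]
  conv_lhs => rw [hfk, Real.fourierInv_eq']
  have hsc := Measure.integral_comp_inv_smul_of_nonneg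
    (volume : Measure (EuclideanSpace ℝ (Fin d)))
    (fun v => Complex.exp (((2 * Real.pi * inner ℝ v t : ℝ) : ℂ) * Complex.I) • k v)
    (R := 2 * Real.pi) (by positivity)
  rw [finrank_euclideanSpace_fin] at hsc
  -- The normalisations of `synth` and `fourierL2` cancel the Jacobian `(2π)^d` of the rescaling.
  have hsplit : (((2 * Real.pi) ^ (-(d : ℝ) / 2) : ℝ) : ℂ) * (((2 * Real.pi) ^ (-(d : ℝ) / 2) : ℝ) : ℂ)
      * (((2 * Real.pi) ^ d : ℝ) : ℂ) = 1 := by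
    rw [← Complex.ofReal_mul, ← Complex.ofReal_mul, ← Real.rpow_add (by positivity),
      ← Real.rpow_natCast, ← Real.rpow_add (by positivity)]
    ring_nf
    simp
  calc _ = (((2 * Real.pi) ^ (-(d : ℝ) / 2) : ℝ) : ℂ) * ((((2 * Real.pi) ^ (-(d : ℝ) / 2) : ℝ) : ℂ)
      * ((((2 * Real.pi) ^ d : ℝ) : ℂ) *
        ∫ v, Complex.exp (((2 * Real.pi * inner ℝ v t : ℝ) : ℂ) * Complex.I) • k v)) := by
        rw [← mul_assoc, ← mul_assoc, hsplit, one_mul]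
    _ = _ := by
      rw [← Complex.real_smul (x := (2 * Real.pi) ^ d), ← hsc, ← integral_const_mul]
      congr 2
      funext ξ
      rw [hdef, Pi.smul_apply, inner_smul_left, smul_eq_mul, smul_eq_mul, mul_left_comm]
      congr 2
      rw [mul_comm Complex.I]
      congr 3
      simp
      field_simp

end

/-! ### Hilbert space tools: synthesis operators, least squares, multiplication operators -/

section

open scoped ComplexConjugate InnerProductSpace

/-- The sequence space `ℓ₂(ℕ)`. -/
abbrev EllTwo := lp (fun _ : ℕ => ℂ) 2

theorem hasSum_norm_sq (a : EllTwo) : HasSum (fun j => ‖a j‖ ^ 2) (‖a‖ ^ 2) := by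
  have h := lp.hasSum_norm (p := 2) (by norm_num) a
  simpa using h

theorem norm_sum_single_sq (s : Finset ℕ) (c : ℕ → ℂ) :
    ‖(∑ j ∈ s, lp.single 2 j (c j) : EllTwo)‖ ^ 2 = ∑ j ∈ s, ‖c j‖ ^ 2 := by
  have h := lp.norm_sum_single (E := fun _ : ℕ => ℂ) (p := 2) (by norm_num) c s
  simpa using h

theorem sum_single_apply (s : Finset ℕ) (c : ℕ → ℂ) (i : ℕ) :
    (∑ j ∈ s, lp.single 2 j (c j) : EllTwo) i = if i ∈ s then c i else 0 := by
  rw [lp.coeFn_sum, Finset.sum_apply]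
  simp [lp.single_apply, Pi.single_apply]

variable {H : Type*} [NormedAddCommGroup H] [InnerProductSpace ℂ H]

/-- The synthesis operator of a Bessel sequence. -/
theorem exists_synthesis [CompleteSpace H] (v : ℕ → H) {K : ℝ} (hK : 0 ≤ K)
    (h : ∀ (s : Finset ℕ) (c : ℕ → ℂ),
      ‖∑ j ∈ s, c j • v j‖ ^ 2 ≤ K ^ 2 * ∑ j ∈ s, ‖c j‖ ^ 2) :
    ∃ T : EllTwo →L[ℂ] H, (∀ a, HasSum (fun j => a j • v j) (T a)) ∧ ∀ a, ‖T a‖ ≤ K * ‖a‖ := by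
  have hs : ∀ a : EllTwo, Summable fun j => a j • v j := by
    intro a
    rw [summable_iff_vanishing_norm]
    intro ε hε
    -- The summand `1` in the tolerance covers `K = 0`.
    obtain ⟨s, hs⟩ := summable_iff_vanishing_norm.1 (hasSum_norm_sq a).summable
      (ε ^ 2 / (K ^ 2 + 1)) (by positivity)
    refine ⟨s, fun t ht => ?_⟩
    have h1 := h t a
    have h2 := hs t ht
    rw [Real.norm_of_nonneg (Finset.sum_nonneg fun _ _ => by positivity),
      lt_div_iff₀ (by positivity)] at h2
    refine lt_of_pow_lt_pow_left₀ 2 hε.le (h1.trans_lt ?_)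
    have : 0 ≤ ∑ j ∈ t, ‖a j‖ ^ 2 := Finset.sum_nonneg fun _ _ => by positivity
    nlinarith
  have hb : ∀ a : EllTwo, ‖∑' j, a j • v j‖ ≤ K * ‖a‖ := by
    intro a
    refine le_of_tendsto (hs a).hasSum.norm (Eventually.of_forall fun s => ?_)
    refine (pow_le_pow_iff_left₀ (norm_nonneg _) (by positivity) two_ne_zero).1 ((h s a).trans ?_)
    rw [mul_pow]
    gcongr
    exact sum_le_hasSum s (fun _ _ => by positivity) (hasSum_norm_sq a)
  refine ⟨LinearMap.mkContinuous
    { toFun := fun a => ∑' j, a j • v j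
      map_add' := fun a b => ?_
      map_smul' := fun c a => ?_ } K hb, fun a => (hs a).hasSum, hb⟩
  · rw [← (hs a).tsum_add (hs b)]
    exact tsum_congr fun j => by simp [add_smul]
  · rw [RingHom.id_apply, ← (hs a).tsum_const_smul c]
    exact tsum_congr fun j => by simp [mul_smul]

/-- Least squares for an operator that is bounded below. -/
theorem existsUnique_leastSquares {V : Type*} [NormedAddCommGroup V] [InnerProductSpace ℂ V]
    [CompleteSpace V] [CompleteSpace H] (T : V →L[ℂ] H) {c : ℝ} (hc : 0 < c)
    (hT : ∀ a, c * ‖a‖ ≤ ‖T a‖) (q : H) : ∃! a, ∀ b, ⟪T b, T a - q⟫_ℂ = 0 := by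
  -- The form `⟪T* T a, a⟫ = ‖T a‖² ≥ c² ‖a‖²` is coercive, so `T* T` is invertible.
  have hunit : IsUnit (T.adjoint ∘L T) := by
    refine ContinuousLinearMap.isUnit_of_forall_le_norm_inner_map _
      (c := Real.toNNReal (c ^ 2)) (Real.toNNReal_pos.2 (by positivity)) fun a => ?_
    rw [ContinuousLinearMap.comp_apply, ContinuousLinearMap.adjoint_inner_left,
      inner_self_eq_norm_sq_to_K]
    have := pow_le_pow_left₀ (by positivity) (hT a) 2
    simp only [Real.coe_toNNReal _ (sq_nonneg c), Complex.coe_algebraMap, norm_pow, Complex.norm_real, norm_norm]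
    nlinarith
  have hbij : Function.Bijective (T.adjoint ∘L T) :=
    (ContinuousLinearMap.isUnit_iff_bijective).1 hunit
  have key : ∀ a, (∀ b, ⟪T b, T a - q⟫_ℂ = 0) ↔ (T.adjoint ∘L T) a = T.adjoint q := by
    intro a
    rw [ContinuousLinearMap.comp_apply, ← sub_eq_zero, ← map_sub]
    constructor
    · intro h
      rw [← inner_self_eq_zero (𝕜 := ℂ), ContinuousLinearMap.adjoint_inner_right]
      exact h _
    · intro h b
      rw [← ContinuousLinearMap.adjoint_inner_right, h, inner_zero_right]
  simp only [key]
  exact hbij.existsUnique _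

/-- Pythagoras: `T b - q` is the orthogonal sum of `T (b - a)` and the residual. -/
theorem norm_leastSquares_le {V : Type*} [NormedAddCommGroup V] [InnerProductSpace ℂ V]
    {T : V →L[ℂ] H} {q : H} {a : V} (ha : ∀ b, ⟪T b, T a - q⟫_ℂ = 0) (b : V) :
    ‖T a - q‖ ≤ ‖T b - q‖ := by
  have h0 : ⟪T (b - a), T a - q⟫_ℂ = 0 := ha _
  have h1 : T b - q = T (b - a) + (T a - q) := by rw [map_sub]; abel
  have h2 := norm_add_sq_eq_norm_sq_add_norm_sq_of_inner_eq_zero _ _ h0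
  rw [h1]
  nlinarith [norm_nonneg (T a - q), norm_nonneg (T (b - a) + (T a - q)),
    mul_self_nonneg ‖T (b - a)‖]

variable {X : Type*} [MeasurableSpace X] {μ : Measure X}

/-- Bounded measurable real functions. -/
def IsMultiplier (w : X → ℝ) : Prop := Measurable w ∧ ∃ C, ∀ x, |w x| ≤ C

theorem IsMultiplier.memLp {w : X → ℝ} (hw : IsMultiplier w) {f : X → ℂ} (hf : MemLp f 2 μ) :
    MemLp (fun x => (w x : ℂ) * f x) 2 μ := by
  obtain ⟨hm, C, hC⟩ := hw
  refine MemLp.of_le_mul (c := C) hf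
    ((Complex.measurable_ofReal.comp hm).aestronglyMeasurable.mul hf.1)
    (Eventually.of_forall fun x => ?_)
  rw [norm_mul, Complex.norm_real]
  exact mul_le_mul_of_nonneg_right (hC x) (norm_nonneg _)

/-- The multiplication operator on `L₂` with a bounded measurable real function. -/
def mulL2 (μ : Measure X) {w : X → ℝ} (hw : IsMultiplier w) : Lp ℂ 2 μ →L[ℂ] Lp ℂ 2 μ :=
  LinearMap.mkContinuous
    { toFun := fun f => (hw.memLp (Lp.memLp f)).toLp _
      map_add' := fun f g => by
        rw [← MemLp.toLp_add]
        refine MemLp.toLp_congr _ _ ?_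
        filter_upwards [Lp.coeFn_add f g] with x hx
        rw [hx, Pi.add_apply, Pi.add_apply, mul_add]
      map_smul' := fun c f => by
        rw [RingHom.id_apply, ← MemLp.toLp_const_smul]
        refine MemLp.toLp_congr _ _ ?_
        filter_upwards [Lp.coeFn_smul c f] with x hx
        rw [hx, Pi.smul_apply, Pi.smul_apply, smul_eq_mul, smul_eq_mul, mul_left_comm] }
    hw.2.choose fun f => by
      refine Lp.norm_le_mul_norm_of_ae_le_mul ?_
      filter_upwards [MemLp.coeFn_toLp (hw.memLp (Lp.memLp f))] with x hx
      change ‖(MemLp.toLp _ (hw.memLp (Lp.memLp f))) x‖ ≤ _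
      rw [hx, norm_mul, Complex.norm_real]
      exact mul_le_mul_of_nonneg_right (hw.2.choose_spec x) (norm_nonneg _)

theorem coeFn_mulL2 {w : X → ℝ} (hw : IsMultiplier w) (f : Lp ℂ 2 μ) :
    mulL2 μ hw f =ᵐ[μ] fun x => (w x : ℂ) * f x :=
  MemLp.coeFn_toLp (hw.memLp (Lp.memLp f))

theorem inner_mulL2_left {w : X → ℝ} (hw : IsMultiplier w) (f g : Lp ℂ 2 μ) :
    ⟪mulL2 μ hw f, g⟫_ℂ = ⟪f, mulL2 μ hw g⟫_ℂ := by
  rw [L2.inner_def, L2.inner_def]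
  refine integral_congr_ae ?_
  filter_upwards [coeFn_mulL2 hw f, coeFn_mulL2 hw g] with x hf hg
  simp only [hf, hg, RCLike.inner_apply, map_mul, Complex.conj_ofReal]
  ring

theorem enorm_sq_eq_lintegral (f : Lp ℂ 2 μ) : ‖f‖ₑ ^ 2 = ∫⁻ x, ‖f x‖ₑ ^ 2 ∂μ := by
  rw [Lp.enorm_def]
  have := eLpNorm_nnreal_pow_eq_lintegral (f := f) (μ := μ) (p := 2) (by norm_num)
  simpa using this

end

/-! ### Exponentials, Gaussian weights and the weighted Bessel inequality -/

section

open scoped ComplexConjugate InnerProductSpace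

variable {d : ℕ}

/-- The exponential `exp(-i⟨y, ξ⟩)`. -/
def expo (y ξ : EuclideanSpace ℝ (Fin d)) : ℂ :=
  Complex.exp (-(Complex.I * ((inner ℝ y ξ : ℝ) : ℂ)))

/-- The Gaussian weight `exp(-s‖ξ‖²)`. -/
def weight (s : ℝ) (ξ : EuclideanSpace ℝ (Fin d)) : ℝ := Real.exp (-(s * ‖ξ‖ ^ 2))

theorem continuous_expo (y : EuclideanSpace ℝ (Fin d)) : Continuous (expo y) := by
  unfold expo; fun_prop

theorem norm_expo (y ξ : EuclideanSpace ℝ (Fin d)) : ‖expo y ξ‖ = 1 := by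
  have : -(Complex.I * ((inner ℝ y ξ : ℝ) : ℂ)) = ((-inner ℝ y ξ : ℝ) : ℂ) * Complex.I := by
    push_cast; ring
  rw [expo, this, Complex.norm_exp_ofReal_mul_I]

theorem expo_add (y ξ t : EuclideanSpace ℝ (Fin d)) : expo y (ξ + t) = expo y t * expo y ξ := by
  rw [expo, expo, expo, ← Complex.exp_add, inner_add_right]
  congr 1
  push_cast
  ring

theorem continuous_weight (s : ℝ) : Continuous (weight s : EuclideanSpace ℝ (Fin d) → ℝ) := by
  unfold weight; fun_prop

theorem weight_pos (s : ℝ) (ξ : EuclideanSpace ℝ (Fin d)) : 0 < weight s ξ := Real.exp_pos _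

theorem weight_mul_weight (s t : ℝ) (ξ : EuclideanSpace ℝ (Fin d)) :
    weight s ξ * weight t ξ = weight (s + t) ξ := by
  rw [weight, weight, weight, ← Real.exp_add]
  ring_nf

theorem ofReal_weight_mul_weight (s t : ℝ) (ξ : EuclideanSpace ℝ (Fin d)) :
    (weight s ξ : ℂ) * (weight t ξ : ℂ) = (weight (s + t) ξ : ℂ) := by
  rw [← Complex.ofReal_mul, weight_mul_weight]

theorem weight_zero (ξ : EuclideanSpace ℝ (Fin d)) : weight 0 ξ = 1 := by simp [weight]

theorem weight_le_one {s : ℝ} (hs : 0 ≤ s) (ξ : EuclideanSpace ℝ (Fin d)) : weight s ξ ≤ 1 := by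
  rw [weight, Real.exp_le_one_iff]
  have := mul_nonneg hs (sq_nonneg ‖ξ‖)
  linarith

theorem isMultiplier_weight {s : ℝ} (hs : 0 ≤ s) :
    IsMultiplier (weight s : EuclideanSpace ℝ (Fin d) → ℝ) :=
  ⟨(continuous_weight s).measurable, 1, fun ξ => by
    rw [abs_of_pos (weight_pos s ξ)]; exact weight_le_one hs ξ⟩

theorem integrable_weight {s : ℝ} (hs : 0 < s) :
    Integrable (weight s : EuclideanSpace ℝ (Fin d) → ℝ) := by
  have h := (GaussianFourier.integrable_cexp_neg_mul_sq_norm_add (b := (s : ℂ)) (by simpa using hs)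
    0 (0 : EuclideanSpace ℝ (Fin d))).norm
  refine h.congr (Eventually.of_forall fun ξ => ?_)
  simp only [zero_mul, add_zero]
  have : -(s : ℂ) * (‖ξ‖ : ℂ) ^ 2 = ((-(s * ‖ξ‖ ^ 2) : ℝ) : ℂ) := by push_cast; ring
  rw [this, ← Complex.ofReal_exp, Complex.norm_real, Real.norm_of_nonneg (Real.exp_pos _).le, weight]

theorem memLp_weight_mul_expo {s : ℝ} (hs : 0 < s) (y : EuclideanSpace ℝ (Fin d)) :
    MemLp (fun ξ => (weight s ξ : ℂ) * expo y ξ) 2 volume := by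
  have hc : Continuous fun ξ : EuclideanSpace ℝ (Fin d) => (weight s ξ : ℂ) * expo y ξ :=
    (Complex.continuous_ofReal.comp (continuous_weight s)).mul (continuous_expo y)
  rw [memLp_two_iff_integrable_sq_norm hc.aestronglyMeasurable]
  refine (integrable_weight (s := s + s) (by positivity)).congr (Eventually.of_forall fun ξ => ?_)
  simp only [norm_mul, norm_expo, mul_one, Complex.norm_real, Real.norm_of_nonneg (weight_pos s ξ).le]
  rw [← weight_mul_weight, sq]

/-- From `‖t‖² ≤ 2‖η + t‖² + 2‖η‖²`; halving the exponent pays for the shift. -/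
theorem weight_add_le (η t : EuclideanSpace ℝ (Fin d)) (hη : ‖η‖ ≤ 1) :
    weight 1 (η + t) ≤ Real.exp 1 * weight (1 / 2) t := by
  rw [weight, weight, ← Real.exp_add, Real.exp_le_exp]
  have h1 : ‖t‖ ≤ ‖η + t‖ + ‖η‖ := by
    have := norm_sub_le (η + t) η
    simpa using this
  have h2 : ‖t‖ ^ 2 ≤ (‖η + t‖ + ‖η‖) ^ 2 := pow_le_pow_left₀ (norm_nonneg _) h1 2
  nlinarith [sq_nonneg (‖η + t‖ - ‖η‖), norm_nonneg η]

/-- A Bessel bound for exponentials on a ball spreads to a Gaussian-weighted Bessel bound on the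
whole space. -/
theorem exists_weighted_bessel {δ : ℝ} (hδ : 0 < δ) (hδ1 : δ ≤ 1)
    (x : ℕ → EuclideanSpace ℝ (Fin d)) {R : ℝ≥0∞} (hR : R ≠ ⊤)
    (h : ∀ (s : Finset ℕ) (c : ℕ → ℂ),
      ∫⁻ ξ in Metric.closedBall 0 δ, ‖∑ j ∈ s, c j * expo (x j) ξ‖ₑ ^ 2 ≤
        R * ∑ j ∈ s, ‖c j‖ₑ ^ 2) :
    ∃ K : ℝ≥0∞, K ≠ ⊤ ∧ ∀ (s : Finset ℕ) (c : ℕ → ℂ),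
      ∫⁻ ξ, ENNReal.ofReal (weight 1 ξ) * ‖∑ j ∈ s, c j * expo (x j) ξ‖ₑ ^ 2 ≤
        K * ∑ j ∈ s, ‖c j‖ₑ ^ 2 := by
  set B : Set (EuclideanSpace ℝ (Fin d)) := Metric.closedBall 0 δ with hB
  have hB0 : volume B ≠ 0 := (Metric.measure_closedBall_pos volume _ hδ).ne'
  have hBtop : volume B ≠ ⊤ := measure_closedBall_lt_top.ne
  set I : ℝ≥0∞ := ∫⁻ t : EuclideanSpace ℝ (Fin d), ENNReal.ofReal (Real.exp 1 * weight (1 / 2) t)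
    with hI
  have hItop : I ≠ ⊤ :=
    ((integrable_weight (by norm_num)).const_mul (Real.exp 1)).lintegral_lt_top.ne
  refine ⟨(volume B)⁻¹ * (I * R), by finiteness, fun s c => ?_⟩
  have hGc : Continuous fun ξ => ∑ j ∈ s, c j * expo (x j) ξ :=
    continuous_finsetSum _ fun j _ => continuous_const.mul (continuous_expo _)
  set G : EuclideanSpace ℝ (Fin d) → ℝ≥0∞ := fun ξ =>
    ENNReal.ofReal (weight 1 ξ) * ‖∑ j ∈ s, c j * expo (x j) ξ‖ₑ ^ 2 with hG
  have hGm : Measurable G :=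
    (continuous_weight 1).measurable.ennreal_ofReal.mul (hGc.enorm.measurable.pow_const 2)
  -- The integral over the whole space is averaged over the translates of `B`. A translation by `t`
  -- only multiplies the coefficients by unimodular numbers, so the bound on `B` applies for each
  -- `t`, and the remaining weight is integrable in `t`.
  have h1 : volume B * ∫⁻ ξ, G ξ ≤ I * (R * ∑ j ∈ s, ‖c j‖ₑ ^ 2) := by
    calc volume B * ∫⁻ ξ, G ξ = ∫⁻ η in B, ∫⁻ t, G (η + t) := by
          simp only [lintegral_add_left_eq_self G, lintegral_const, Measure.restrict_apply_univ]
          rw [mul_comm]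
      _ = ∫⁻ t, ∫⁻ η in B, G (η + t) := by
          rw [lintegral_lintegral_swap]
          exact (hGm.comp (measurable_fst.add measurable_snd)).aemeasurable
      _ ≤ ∫⁻ t, ENNReal.ofReal (Real.exp 1 * weight (1 / 2) t) * (R * ∑ j ∈ s, ‖c j‖ₑ ^ 2) := by
          refine lintegral_mono fun t => ?_
          have h2 := h s fun j => c j * expo (x j) t
          simp only [enorm_mul] at h2
          have h3 : ∀ j, ‖expo (x j) t‖ₑ = 1 := fun j => by
            rw [← ofReal_norm, norm_expo, ENNReal.ofReal_one]
          simp only [h3, mul_one] at h2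
          refine le_trans ?_ (mul_le_mul_right h2 _)
          rw [← lintegral_const_mul' _ _ ENNReal.ofReal_ne_top]
          refine setLIntegral_mono' measurableSet_closedBall fun η hη => ?_
          simp only [hG, expo_add, mul_assoc]
          gcongr
          exact weight_add_le η t ((mem_closedBall_zero_iff.1 hη).trans hδ1)
      _ = I * (R * ∑ j ∈ s, ‖c j‖ₑ ^ 2) := by
          rw [lintegral_mul_const]
          exact ((continuous_weight _).measurable.const_mul _).ennreal_ofReal
  calc ∫⁻ ξ, G ξ = (volume B)⁻¹ * (volume B * ∫⁻ ξ, G ξ) := by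
        rw [← mul_assoc, ENNReal.inv_mul_cancel hB0 hBtop, one_mul]
    _ ≤ (volume B)⁻¹ * (I * (R * ∑ j ∈ s, ‖c j‖ₑ ^ 2)) := by gcongr
    _ = _ := by ring

theorem coeFn_sum_smul {X : Type*} [MeasurableSpace X] {μ : Measure X} {e : ℕ → Lp ℂ 2 μ}
    {g : ℕ → X → ℂ} (he : ∀ j, e j =ᵐ[μ] g j) (s : Finset ℕ) (c : ℕ → ℂ) :
    ⇑(∑ j ∈ s, c j • e j) =ᵐ[μ] fun x => ∑ j ∈ s, c j * g j x := by
  induction s using Finset.induction_on with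
  | empty =>
    filter_upwards [Lp.coeFn_zero ℂ 2 μ] with x hx
    simpa using hx
  | insert i s hi ih =>
    rw [Finset.sum_insert hi]
    filter_upwards [Lp.coeFn_add (c i • e i) (∑ j ∈ s, c j • e j), Lp.coeFn_smul (c i) (e i),
      he i, ih] with x h1 h2 h3 h4
    rw [h1, Pi.add_apply, h2, Pi.smul_apply, h3, h4, Finset.sum_insert hi, smul_eq_mul]

theorem sum_enorm_sq (s : Finset ℕ) (c : ℕ → ℂ) :
    ∑ j ∈ s, ‖c j‖ₑ ^ 2 = ENNReal.ofReal (∑ j ∈ s, ‖c j‖ ^ 2) := by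
  rw [ENNReal.ofReal_sum_of_nonneg fun _ _ => by positivity]
  exact Finset.sum_congr rfl fun j _ => by
    rw [ENNReal.ofReal_pow (norm_nonneg _), ofReal_norm]

/-- The upper Riesz bound applied to finitely supported sequences. -/
theorem lintegral_sum_expo_le {Z : Set (EuclideanSpace ℝ (Fin d))}
    {x : ℕ → EuclideanSpace ℝ (Fin d)} {e : ℕ → Lp ℂ 2 (volume.restrict Z)}
    (he : ∀ j, e j =ᵐ[volume.restrict Z] expo (x j)) {R : ℝ} (hR : 0 < R)
    (h : ∀ c : EllTwo, ‖∑' j, c j • e j‖ ≤ R * ‖c‖) (s : Finset ℕ) (c : ℕ → ℂ) :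
    ∫⁻ ξ in Z, ‖∑ j ∈ s, c j * expo (x j) ξ‖ₑ ^ 2 ≤
      ENNReal.ofReal (R ^ 2) * ∑ j ∈ s, ‖c j‖ₑ ^ 2 := by
  have h1 := h (∑ j ∈ s, lp.single 2 j (c j))
  have h2 : ∑' j, (∑ j ∈ s, lp.single 2 j (c j) : EllTwo) j • e j = ∑ j ∈ s, c j • e j := by
    rw [tsum_eq_sum (s := s)]
    · exact Finset.sum_congr rfl fun j hj => by rw [sum_single_apply, if_pos hj]
    · intro j hj
      rw [sum_single_apply, if_neg hj, zero_smul]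
  rw [h2] at h1
  have h3 : ‖∑ j ∈ s, c j • e j‖ₑ ^ 2 = ∫⁻ ξ in Z, ‖∑ j ∈ s, c j * expo (x j) ξ‖ₑ ^ 2 := by
    rw [enorm_sq_eq_lintegral]
    refine lintegral_congr_ae ?_
    filter_upwards [coeFn_sum_smul he s c] with ξ hξ
    rw [hξ]
  rw [← h3]
  rw [sum_enorm_sq, ← ENNReal.ofReal_mul (by positivity), ← ofReal_norm, ← ENNReal.ofReal_pow (norm_nonneg _)]
  refine ENNReal.ofReal_le_ofReal ?_
  rw [← norm_sum_single_sq, ← mul_pow]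
  exact pow_le_pow_left₀ (norm_nonneg _) h1 2

end

/-! ### The weighted synthesis operator and the Riesz basis property on `Z` -/

section

open scoped ComplexConjugate InnerProductSpace

variable {d : ℕ}

/-- The synthesis operator `a ↦ ∑_j a_j exp(-s‖ξ‖²) exp(-i⟨x_j, ξ⟩)` in `L₂(ℝ^d)`. -/
def IsWeightedSynthesis (s : ℝ) (x : ℕ → EuclideanSpace ℝ (Fin d))
    (T : EllTwo →L[ℂ] L2Space d) : Prop :=
  ∀ j, T (lp.single 2 j 1) =ᵐ[volume] fun ξ => (weight s ξ : ℂ) * expo (x j) ξ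

theorem hasSum_smul_single {H : Type*} [NormedAddCommGroup H] [InnerProductSpace ℂ H]
    (T : EllTwo →L[ℂ] H) (a : EllTwo) :
    HasSum (fun j => a j • T (lp.single 2 j 1)) (T a) := by
  have h := (lp.hasSum_single (E := fun _ : ℕ => ℂ) (p := 2) (by norm_num) a).mapL T
  refine h.congr_fun fun j => ?_
  rw [← map_smul, ← lp.single_smul]
  simp

theorem exists_isWeightedSynthesis {δ : ℝ} (hδ : 0 < δ) (hδ1 : δ ≤ 1)
    {x : ℕ → EuclideanSpace ℝ (Fin d)} {R : ℝ≥0∞} (hR : R ≠ ⊤)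
    (h : ∀ (s : Finset ℕ) (c : ℕ → ℂ),
      ∫⁻ ξ in Metric.closedBall 0 δ, ‖∑ j ∈ s, c j * expo (x j) ξ‖ₑ ^ 2 ≤
        R * ∑ j ∈ s, ‖c j‖ₑ ^ 2) :
    ∃ T : EllTwo →L[ℂ] L2Space d, IsWeightedSynthesis (1 / 2) x T := by
  obtain ⟨K, hK, hKb⟩ := exists_weighted_bessel hδ hδ1 x hR h
  set v : ℕ → L2Space d := fun j =>
    (memLp_weight_mul_expo (s := 1 / 2) (by norm_num) (x j)).toLp _ with hv
  have hve : ∀ j, v j =ᵐ[volume] fun ξ => (weight (1 / 2) ξ : ℂ) * expo (x j) ξ :=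
    fun j => MemLp.coeFn_toLp _
  obtain ⟨T, hT, -⟩ := exists_synthesis v (K := √K.toReal) (by positivity) fun s c => by
    have h1 : ‖∑ j ∈ s, c j • v j‖ₑ ^ 2 ≤ K * ∑ j ∈ s, ‖c j‖ₑ ^ 2 := by
      refine le_trans (le_of_eq ?_) (hKb s c)
      rw [enorm_sq_eq_lintegral]
      refine lintegral_congr_ae ?_
      filter_upwards [coeFn_sum_smul hve s c] with ξ hξ
      rw [hξ]
      have : ∑ j ∈ s, c j * ((weight (1 / 2) ξ : ℂ) * expo (x j) ξ) =
          (weight (1 / 2) ξ : ℂ) * ∑ j ∈ s, c j * expo (x j) ξ := by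
        rw [Finset.mul_sum]
        exact Finset.sum_congr rfl fun j _ => mul_left_comm _ _ _
      rw [this, enorm_mul, mul_pow, ← ofReal_norm, Complex.norm_real,
        Real.norm_of_nonneg (weight_pos _ _).le, ← ENNReal.ofReal_pow (weight_pos _ _).le, sq,
        weight_mul_weight]
      norm_num
    rw [Real.sq_sqrt ENNReal.toReal_nonneg]
    have h2 := ENNReal.toReal_mono (by rw [sum_enorm_sq]; finiteness) h1
    rw [sum_enorm_sq, ENNReal.toReal_mul, ENNReal.toReal_ofReal
      (Finset.sum_nonneg fun _ _ => by positivity), ENNReal.toReal_pow, toReal_enorm] at h2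
    exact h2
  refine ⟨T, fun j => ?_⟩
  have h1 : T (lp.single 2 j 1) = v j := by
    refine (hT _).unique ?_
    have h2 := hasSum_single (f := fun i => (lp.single 2 j (1 : ℂ) : EllTwo) i • v i) j
      fun i hi => by
        change (lp.single 2 j (1 : ℂ) : EllTwo) i • v i = 0
        rw [lp.single_apply_ne _ _ _ hi, zero_smul]
    simpa using h2
  rw [h1]
  exact hve j

/-- On `Z` the weighted synthesis operator inherits the Riesz basis property. -/
theorem exists_synthesis_of_isRieszBasisSequence {δ : ℝ} (hδ : 0 < δ) (hδ1 : δ ≤ 1)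
    {Z : Set (EuclideanSpace ℝ (Fin d))} (hZm : MeasurableSet Z)
    (hδZ : Metric.closedBall 0 δ ⊆ Z) (hZ1 : Z ⊆ Metric.closedBall 0 1)
    {x : ℕ → EuclideanSpace ℝ (Fin d)} (hx : IsRieszBasisSequence Z x) :
    ∃ (Ψ : EllTwo →L[ℂ] L2Space d) (R : ℝ), 0 < R ∧ IsWeightedSynthesis (1 / 2) x Ψ ∧
      (∀ (a : EllTwo) (g : L2Space d), (∀ᵐ ξ, ξ ∈ Z → ‖Ψ a ξ‖ ≤ ‖g ξ‖) → ‖a‖ ≤ R * ‖g‖) ∧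
      ∀ h : L2Space d, ∃ b, ‖Ψ b‖ ≤ R * ‖h‖ ∧
        ∀ᵐ ξ, ξ ∈ Z → Ψ b ξ = (weight (1 / 2) ξ : ℂ) * h ξ := by
  obtain ⟨e, he, hexp, R, hR, hRb⟩ := hx
  have hsum : ∀ c : EllTwo, Summable fun j => c j • e j := fun c => (hRb c).1
  obtain ⟨Ψ, hΨ⟩ := exists_isWeightedSynthesis hδ hδ1 (x := x)
    (R := ENNReal.ofReal (R ^ 2)) ENNReal.ofReal_ne_top fun s c =>
      (lintegral_mono_set hδZ).trans
        (lintegral_sum_expo_le he hR (fun c => (hRb c).2.2) s c)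
  set N := mulL2 (volume.restrict Z) (isMultiplier_weight (d := d) (s := 1 / 2) (by norm_num))
  set ρ := LpToLpRestrictCLM (EuclideanSpace ℝ (Fin d)) ℂ ℂ volume 2 Z with hρ
  have hρc : ∀ f : L2Space d, ρ f =ᵐ[volume.restrict Z] f := LpToLpRestrictCLM_coeFn ℂ Z
  have hρn : ∀ f : L2Space d, ‖ρ f‖ ≤ ‖f‖ := by
    intro f
    have h1 : ‖ρ f‖ₑ ^ 2 ≤ ‖f‖ₑ ^ 2 := by
      rw [enorm_sq_eq_lintegral, enorm_sq_eq_lintegral]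
      refine (lintegral_congr_ae ?_).trans_le (setLIntegral_le_lintegral Z _)
      filter_upwards [hρc f] with ξ hξ
      rw [hξ]
    rw [ENNReal.pow_le_pow_left_iff two_ne_zero] at h1
    exact enorm_le_iff_norm_le.1 h1
  have hNρ : ∀ j, ρ (Ψ (lp.single 2 j 1)) = N (e j) := by
    intro j
    refine Lp.ext ?_
    filter_upwards [hρc (Ψ (lp.single 2 j 1)), ae_restrict_of_ae (hΨ j), coeFn_mulL2 _ (e j), he j]
      with ξ h1 h2 h3 h4
    rw [h1, h2, h3, h4, expo]
  -- On `Z`, `Ψ` is the Riesz basis synthesis followed by multiplication with the weight; this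
  -- transfers both the lower bound and surjectivity.
  have hkey : ∀ (a : EllTwo) (h : Lp ℂ 2 (volume.restrict Z)), HasSum (fun j => a j • e j) h →
      ρ (Ψ a) = N h := by
    intro a h hh
    refine ((hasSum_smul_single Ψ a).mapL ρ).unique ((hh.mapL N).congr_fun fun j => ?_)
    rw [map_smul, map_smul, hNρ]
  -- The first constant undoes the weight, which is at least `exp(-1/2)` on `Z ⊆ B₂`; the second
  -- bounds `‖Ψ b‖` by `‖Ψ‖ ‖b‖` and the coefficients `b` by the lower Riesz bound.
  refine ⟨Ψ, max (R * Real.exp (1 / 2)) (‖Ψ‖ * R), by positivity, hΨ, fun a g hg => ?_, fun h => ?_⟩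
  · have h1 := (hRb a).2.1
    set h := ∑' j, a j • e j with hh
    have h2 := hkey a h (hsum a).hasSum
    have h3 : ‖h‖ ≤ Real.exp (1 / 2) * ‖ρ (Ψ a)‖ := by
      refine Lp.norm_le_mul_norm_of_ae_le_mul ?_
      rw [h2]
      filter_upwards [coeFn_mulL2 _ h, ae_restrict_mem hZm] with ξ h4 hξ
      rw [h4, norm_mul, Complex.norm_real, Real.norm_of_nonneg (weight_pos _ _).le, ← mul_assoc,
        weight, ← Real.exp_add]
      refine le_mul_of_one_le_left (norm_nonneg _) (Real.one_le_exp ?_)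
      have h5 := mem_closedBall_zero_iff.1 (hZ1 hξ)
      nlinarith [norm_nonneg ξ]
    have h4 : ‖ρ (Ψ a)‖ ≤ ‖ρ g‖ := by
      refine Lp.norm_le_norm_of_ae_le ?_
      filter_upwards [hρc (Ψ a), hρc g, (ae_restrict_iff' hZm).2 hg] with ξ h5 h6 h7
      rwa [h5, h6]
    rw [inv_mul_le_iff₀ hR] at h1
    calc ‖a‖ ≤ R * (Real.exp (1 / 2) * ‖g‖) :=
          h1.trans (by gcongr; exact h3.trans (by gcongr; exact h4.trans (hρn _)))
      _ = (R * Real.exp (1 / 2)) * ‖g‖ := by ring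
      _ ≤ _ := by gcongr; exact le_max_left _ _
  · obtain ⟨b, hb, -⟩ := hexp (ρ h)
    refine ⟨b, ?_, ?_⟩
    · have h1 := (hRb b).2.1
      rw [hb.tsum_eq, inv_mul_le_iff₀ hR] at h1
      calc ‖Ψ b‖ ≤ ‖Ψ‖ * ‖b‖ := Ψ.le_opNorm b
        _ ≤ ‖Ψ‖ * (R * ‖h‖) := by gcongr; exact h1.trans (by gcongr; exact hρn h)
        _ = (‖Ψ‖ * R) * ‖h‖ := by ring
        _ ≤ _ := by gcongr; exact le_max_right _ _
    · have h1 := hkey b _ hb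
      rw [← ae_restrict_iff' hZm]
      have h2 := coeFn_mulL2 (isMultiplier_weight (d := d) (s := 1 / 2) (by norm_num)) (ρ h)
      filter_upwards [hρc (Ψ b), hρc h, h2] with ξ h3 h4 h5
      rw [← h3, h1, h5, h4]

end

/-! ### Interpolation equations as normal equations -/

section

open scoped ComplexConjugate InnerProductSpace

variable {d : ℕ}

theorem memLp_weight {s : ℝ} (hs : 0 < s) :
    MemLp (fun ξ : EuclideanSpace ℝ (Fin d) => (weight s ξ : ℂ)) 2 volume := by
  have := memLp_weight_mul_expo hs (0 : EuclideanSpace ℝ (Fin d))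
  simpa [expo] using this

theorem integrable_weight_mul {s : ℝ} (hs : 0 < s) (r : L2Space d) :
    Integrable fun ξ => (weight s ξ : ℂ) * r ξ :=
  (memLp_weight hs).integrable_mul (Lp.memLp r)

/-- The element `exp(-s‖ξ‖²) exp(-i⟨y, ξ⟩)` of `L₂(ℝ^d)`. -/
def weightedExpo {s : ℝ} (hs : 0 < s) (y : EuclideanSpace ℝ (Fin d)) : L2Space d :=
  (memLp_weight_mul_expo hs y).toLp _

theorem coeFn_weightedExpo {s : ℝ} (hs : 0 < s) (y : EuclideanSpace ℝ (Fin d)) :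
    weightedExpo hs y =ᵐ[volume] fun ξ => (weight s ξ : ℂ) * expo y ξ :=
  MemLp.coeFn_toLp _

theorem conj_expo (y ξ : EuclideanSpace ℝ (Fin d)) :
    conj (expo y ξ) = Complex.exp (Complex.I * ((inner ℝ ξ y : ℝ) : ℂ)) := by
  rw [expo, ← Complex.exp_conj, real_inner_comm]
  simp

/-- Point evaluation becomes an inner product, so the values at the nodes `x_k` test against the
columns of `T`. -/
theorem synth_weight_mul {s : ℝ} (hs : 0 < s) (r : L2Space d) (t : EuclideanSpace ℝ (Fin d)) :
    synth (fun ξ => (weight s ξ : ℂ) * r ξ) t =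
      (((2 * Real.pi) ^ (-(d : ℝ) / 2) : ℝ) : ℂ) * ⟪weightedExpo hs t, r⟫_ℂ := by
  rw [synth, L2.inner_def]
  congr 1
  refine integral_congr_ae ?_
  filter_upwards [coeFn_weightedExpo hs t] with ξ h1
  rw [RCLike.inner_apply, h1, map_mul, Complex.conj_ofReal, conj_expo]
  ring

/-- The two half weights combine to `weight α`, whose Fourier integral is again a Gaussian. This
identifies the interpolation matrix with a Gram matrix. -/
theorem inner_weightedExpo {α : ℝ} (hα : 0 < α) (t y : EuclideanSpace ℝ (Fin d)) :
    ⟪weightedExpo (half_pos hα) t, weightedExpo (half_pos hα) y⟫_ℂ =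
      (((Real.pi / α) ^ ((d : ℝ) / 2) : ℝ) : ℂ) * (gaussian α (t - y) : ℂ) := by
  have h := GaussianFourier.integral_cexp_neg_mul_sq_norm_add (b := (α : ℂ)) (by simpa using hα)
    Complex.I (t - y)
  rw [finrank_euclideanSpace_fin] at h
  have h2 : ⟪weightedExpo (half_pos hα) t, weightedExpo (half_pos hα) y⟫_ℂ =
      ∫ v, Complex.exp (-(α : ℂ) * (‖v‖ : ℂ) ^ 2 + Complex.I * ((inner ℝ (t - y) v : ℝ) : ℂ)) := by
    rw [L2.inner_def]
    refine integral_congr_ae ?_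
    filter_upwards [coeFn_weightedExpo (half_pos hα) t, coeFn_weightedExpo (half_pos hα) y]
      with ξ h1 h2
    rw [RCLike.inner_apply, h1, h2, map_mul, Complex.conj_ofReal, conj_expo, expo, weight,
      Complex.ofReal_exp, mul_mul_mul_comm, ← Complex.exp_add, ← Complex.exp_add,
      ← Complex.exp_add, inner_sub_left, real_inner_comm ξ t]
    congr 1
    push_cast
    ring
  rw [h2, h, gaussian, ← Complex.ofReal_div, Complex.ofReal_cpow (by positivity),
    Complex.ofReal_exp]
  congr 2
  · push_cast; rfl
  · push_cast
    rw [Complex.I_sq]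
    ring

theorem IsWeightedSynthesis.apply_single {s : ℝ} (hs : 0 < s) {x : ℕ → EuclideanSpace ℝ (Fin d)}
    {T : EllTwo →L[ℂ] L2Space d} (hT : IsWeightedSynthesis s x T) (j : ℕ) :
    T (lp.single 2 j 1) = weightedExpo hs (x j) :=
  Lp.ext ((hT j).trans (coeFn_weightedExpo hs (x j)).symm)

/-- This derives the operators for all `α ≥ 1` from the single operator `Ψ` with weight `1/2`. -/
theorem IsWeightedSynthesis.mulL2_comp {s t : ℝ} (ht : 0 ≤ t) {x : ℕ → EuclideanSpace ℝ (Fin d)}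
    {T : EllTwo →L[ℂ] L2Space d} (hT : IsWeightedSynthesis s x T) :
    IsWeightedSynthesis (t + s) x (mulL2 volume (isMultiplier_weight ht) ∘L T) := by
  intro j
  rw [ContinuousLinearMap.comp_apply]
  filter_upwards [hT j, coeFn_mulL2 (isMultiplier_weight ht) (T (lp.single 2 j 1))] with ξ h1 h2
  rw [h2, h1, ← mul_assoc, ofReal_weight_mul_weight]

/-- Series of translated Gaussians as inverse Fourier integrals. -/
theorem hasSum_gaussian {α : ℝ} (hα : 0 < α) {x : ℕ → EuclideanSpace ℝ (Fin d)}
    {T : EllTwo →L[ℂ] L2Space d} (hT : IsWeightedSynthesis (α / 2) x T) (a : EllTwo)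
    (t : EuclideanSpace ℝ (Fin d)) :
    HasSum (fun j => a j * (gaussian α (t - x j) : ℂ))
      ((((2 * α) ^ ((d : ℝ) / 2) : ℝ) : ℂ) * synth (fun ξ => (weight (α / 2) ξ : ℂ) * T a ξ) t) := by
  have h1 := ((hasSum_smul_single T a).mapL
    (innerSL ℂ (weightedExpo (half_pos hα) t))).mul_left
      ((((2 * α) ^ ((d : ℝ) / 2) : ℝ) : ℂ) * (((2 * Real.pi) ^ (-(d : ℝ) / 2) : ℝ) : ℂ))
  rw [synth_weight_mul (half_pos hα), ← mul_assoc]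
  refine h1.congr_fun fun j => ?_
  rw [map_smul, innerSL_apply_apply, hT.apply_single (half_pos hα), inner_weightedExpo hα, smul_eq_mul]
  have h2 : (((2 * α) ^ ((d : ℝ) / 2) : ℝ) : ℂ) * (((2 * Real.pi) ^ (-(d : ℝ) / 2) : ℝ) : ℂ) *
      (((Real.pi / α) ^ ((d : ℝ) / 2) : ℝ) : ℂ) = 1 := by
    rw [neg_div, Real.rpow_neg (by positivity), ← Real.inv_rpow (by positivity),
      ← Complex.ofReal_mul, ← Complex.ofReal_mul, ← Real.mul_rpow (by positivity) (by positivity),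
      ← Real.mul_rpow (by positivity) (by positivity)]
    have : 2 * α * (2 * Real.pi)⁻¹ * (Real.pi / α) = 1 := by field_simp
    rw [this, Real.one_rpow, Complex.ofReal_one]
  linear_combination -(a j * (gaussian α (t - x j) : ℂ)) * h2

/-- The interpolation equations are the normal equations of a least squares problem. -/
theorem solvesInterpolation_iff {α : ℝ} (hα : 0 < α) {x : ℕ → EuclideanSpace ℝ (Fin d)}
    {T : EllTwo →L[ℂ] L2Space d} (hT : IsWeightedSynthesis (α / 2) x T)
    {f : EuclideanSpace ℝ (Fin d) → ℂ} {q : L2Space d}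
    (hf : f = synth fun ξ => (weight (α / 2) ξ : ℂ) * q ξ) (a : EllTwo) :
    SolvesInterpolation (gaussian α) x f a ↔
      ∀ b, ⟪T b, T ((((2 * α) ^ ((d : ℝ) / 2) : ℝ) : ℂ) • a) - q⟫_ℂ = 0 := by
  have hc : (((2 * Real.pi) ^ (-(d : ℝ) / 2) : ℝ) : ℂ) ≠ 0 := by
    exact_mod_cast (by positivity : (0 : ℝ) < (2 * Real.pi) ^ (-(d : ℝ) / 2)).ne'
  have h1 : ∀ k, HasSum (fun j => a j * (gaussian α (x k - x j) : ℂ)) (f (x k)) ↔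
      ⟪T (lp.single 2 k 1), T ((((2 * α) ^ ((d : ℝ) / 2) : ℝ) : ℂ) • a) - q⟫_ℂ = 0 := by
    intro k
    have h2 := hasSum_gaussian hα hT a (x k)
    have h3 : HasSum (fun j => a j * (gaussian α (x k - x j) : ℂ)) (f (x k)) ↔
        f (x k) = ((((2 * α) ^ ((d : ℝ) / 2) : ℝ) : ℂ) *
          synth (fun ξ => (weight (α / 2) ξ : ℂ) * T a ξ) (x k)) :=
      ⟨fun h => h.unique h2, fun h => h ▸ h2⟩
    rw [h3, hf, synth_weight_mul (half_pos hα), synth_weight_mul (half_pos hα),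
      hT.apply_single (half_pos hα), inner_sub_right, map_smul, inner_smul_right, sub_eq_zero,
      mul_left_comm, mul_right_inj' hc, eq_comm]
  refine ⟨fun h b => ?_, fun h k => (h1 k).2 (h _)⟩
  have h2 : ∀ k, ⟪T (lp.single 2 k 1), T ((((2 * α) ^ ((d : ℝ) / 2) : ℝ) : ℂ) • a) - q⟫_ℂ = 0 :=
    fun k => (h1 k).1 (h k)
  set r := T ((((2 * α) ^ ((d : ℝ) / 2) : ℝ) : ℂ) • a) - q
  rw [← inner_conj_symm, map_eq_zero]
  -- Orthogonality to the columns extends to the whole range of `T` by continuity.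
  refine ((hasSum_smul_single T b).mapL (innerSL ℂ r)).unique ?_
  refine hasSum_zero.congr_fun fun j => ?_
  rw [map_smul, innerSL_apply_apply, ← inner_conj_symm, h2, map_zero, smul_zero]

/-- The interpolation equations have exactly one solution, and the interpolant is an inverse Fourier
integral. -/
theorem existsUnique_solvesInterpolation {α : ℝ} (hα : 0 < α) {x : ℕ → EuclideanSpace ℝ (Fin d)}
    {T : EllTwo →L[ℂ] L2Space d} (hT : IsWeightedSynthesis (α / 2) x T) {c : ℝ} (hc : 0 < c)
    (hTc : ∀ a, c * ‖a‖ ≤ ‖T a‖) {f : EuclideanSpace ℝ (Fin d) → ℂ} {q : L2Space d}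
    (hf : f = synth fun ξ => (weight (α / 2) ξ : ℂ) * q ξ) :
    (∃! a, SolvesInterpolation (gaussian α) x f a) ∧
      ∃ a, (∀ b, ⟪T b, T a - q⟫_ℂ = 0) ∧
        interpolant (gaussian α) x f = synth fun ξ => (weight (α / 2) ξ : ℂ) * T a ξ := by
  set κ : ℂ := (((2 * α) ^ ((d : ℝ) / 2) : ℝ) : ℂ) with hκ
  have hκ0 : κ ≠ 0 := by
    rw [hκ]
    exact_mod_cast (by positivity : (0 : ℝ) < (2 * α) ^ ((d : ℝ) / 2)).ne'
  obtain ⟨a, ha, hau⟩ := existsUnique_leastSquares T hc hTc q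
  have hsol : SolvesInterpolation (gaussian α) x f (κ⁻¹ • a) := by
    rw [solvesInterpolation_iff hα hT hf, ← hκ, smul_inv_smul₀ hκ0]
    exact ha
  refine ⟨⟨κ⁻¹ • a, hsol, fun b hb => ?_⟩, ?_⟩
  · rw [← hau _ ((solvesInterpolation_iff hα hT hf b).1 hb), ← hκ, inv_smul_smul₀ hκ0]
  · have h1 : SolvesInterpolation (gaussian α) x f (interpolationCoeff (gaussian α) x f) :=
      Classical.epsilon_spec ⟨_, hsol⟩
    refine ⟨κ • interpolationCoeff (gaussian α) x f,
      (solvesInterpolation_iff hα hT hf _).1 h1, funext fun t => ?_⟩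
    rw [interpolant, (hasSum_gaussian hα hT _ t).tsum_eq, synth_weight_mul (half_pos hα),
      synth_weight_mul (half_pos hα), map_smul, inner_smul_right]
    ring

end

/-! ### Error estimates on and off `Z` -/

section

open scoped ComplexConjugate InnerProductSpace

variable {d : ℕ}

theorem weight_le_of_le {s r : ℝ} (hs : 0 ≤ s) (hr : 0 ≤ r) {ξ : EuclideanSpace ℝ (Fin d)}
    (h : r ≤ ‖ξ‖) : weight s ξ ≤ Real.exp (-(s * r ^ 2)) := by
  rw [weight]
  gcongr

theorem isMultiplier_indicator {S : Set (EuclideanSpace ℝ (Fin d))} (hS : MeasurableSet S) :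
    IsMultiplier (S.indicator fun _ => (1 : ℝ)) :=
  ⟨measurable_const.indicator hS, 1, fun ξ => by by_cases h : ξ ∈ S <;> simp [h]⟩

/-- Multiplication with the indicator function of a measurable set. -/
def cutoff {S : Set (EuclideanSpace ℝ (Fin d))} (hS : MeasurableSet S) : L2Space d →L[ℂ] L2Space d :=
  mulL2 volume (isMultiplier_indicator hS)

theorem coeFn_cutoff {S : Set (EuclideanSpace ℝ (Fin d))} (hS : MeasurableSet S) (f : L2Space d) :
    cutoff hS f =ᵐ[volume] S.indicator f := by
  filter_upwards [coeFn_mulL2 (isMultiplier_indicator hS) f] with ξ h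
  rw [cutoff, h]
  by_cases h : ξ ∈ S <;> simp [h]

theorem inner_cutoff_left {S : Set (EuclideanSpace ℝ (Fin d))} (hS : MeasurableSet S)
    (f g : L2Space d) : ⟪cutoff hS f, g⟫_ℂ = ⟪f, cutoff hS g⟫_ℂ :=
  inner_mulL2_left _ f g

theorem cutoff_cutoff {S : Set (EuclideanSpace ℝ (Fin d))} (hS : MeasurableSet S) (f : L2Space d) :
    cutoff hS (cutoff hS f) = cutoff hS f := by
  refine Lp.ext ?_
  filter_upwards [coeFn_cutoff hS (cutoff hS f), coeFn_cutoff hS f] with ξ h1 h2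
  rw [h1]
  by_cases h : ξ ∈ S
  · rw [indicator_of_mem h]
  · rw [indicator_of_notMem h, h2, indicator_of_notMem h]

theorem cutoff_add_cutoff_compl {S : Set (EuclideanSpace ℝ (Fin d))} (hS : MeasurableSet S)
    (f : L2Space d) : cutoff hS f + cutoff hS.compl f = f := by
  refine Lp.ext ?_
  filter_upwards [Lp.coeFn_add (cutoff hS f) (cutoff hS.compl f), coeFn_cutoff hS f,
    coeFn_cutoff hS.compl f] with ξ h1 h2 h3
  rw [h1, Pi.add_apply, h2, h3]
  by_cases h : ξ ∈ S <;> simp [h]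

/-- Points outside `Z` satisfy `‖ξ‖ > δ`. This is the source of all decay in `α`. -/
theorem norm_cutoff_mulL2_weight_le {δ s : ℝ} (hδ : 0 ≤ δ) (hs : 0 ≤ s)
    {Z : Set (EuclideanSpace ℝ (Fin d))} (hZm : MeasurableSet Z)
    (hδZ : Metric.closedBall 0 δ ⊆ Z) (f : L2Space d) :
    ‖cutoff hZm.compl (mulL2 volume (isMultiplier_weight hs) f)‖ ≤
      Real.exp (-(s * δ ^ 2)) * ‖f‖ := by
  refine Lp.norm_le_mul_norm_of_ae_le_mul ?_
  filter_upwards [coeFn_cutoff hZm.compl (mulL2 volume (isMultiplier_weight hs) f),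
    coeFn_mulL2 (isMultiplier_weight hs) f] with ξ h1 h2
  rw [h1]
  by_cases h : ξ ∈ Z
  · rw [indicator_of_notMem (by simpa using h), norm_zero]
    positivity
  · rw [indicator_of_mem (by simpa using h), h2, norm_mul, Complex.norm_real,
      Real.norm_of_nonneg (weight_pos _ _).le]
    refine mul_le_mul_of_nonneg_right (weight_le_of_le hs hδ ?_) (norm_nonneg _)
    by_contra hn
    exact h (hδZ (mem_closedBall_zero_iff.2 (le_of_not_ge hn)))

variable {α β δ R : ℝ} {Z : Set (EuclideanSpace ℝ (Fin d))} {Ψ : EllTwo →L[ℂ] L2Space d}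
  {q h : L2Space d}

/-- The residual of the least squares problem. -/
theorem norm_residual_le (hα : 1 ≤ α) (hδ : 0 ≤ δ) (hR : 0 ≤ R)
    (hZm : MeasurableSet Z) (hδZ : Metric.closedBall 0 δ ⊆ Z)
    (hΨ : ∀ g : L2Space d, ∃ b, ‖Ψ b‖ ≤ R * ‖g‖ ∧
      ∀ᵐ ξ, ξ ∈ Z → Ψ b ξ = (weight (1 / 2) ξ : ℂ) * g ξ)
    (hαn : 0 ≤ (α - 1) / 2)
    (hq : q =ᵐ[volume] fun ξ => Z.indicator (fun ξ => (weight (-(α / 2)) ξ : ℂ) * h ξ) ξ)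
    (hh : ∀ᵐ ξ, ξ ∉ Metric.closedBall (0 : EuclideanSpace ℝ (Fin d)) β → h ξ = 0) {a : EllTwo}
    (ha : ∀ b, ⟪(mulL2 volume (isMultiplier_weight hαn) ∘L Ψ) b,
      (mulL2 volume (isMultiplier_weight hαn) ∘L Ψ) a - q⟫_ℂ = 0) :
    ‖(mulL2 volume (isMultiplier_weight hαn) ∘L Ψ) a - q‖ ≤
      Real.exp (-((α - 1) / 2 * δ ^ 2)) * (R * (Real.exp (α * β ^ 2) * ‖h‖)) := by
  -- The target is `g = weight (-α) · h`, so that `weight ((α-1)/2) · weight (1/2) · g = weight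
  -- (-α/2) · h = q` on `Z`. Cutting off at radius `β` changes nothing on the support of `h` and
  -- bounds the growing factor by `exp(αβ²)`.
  have hgm : IsMultiplier ((Metric.closedBall (0 : EuclideanSpace ℝ (Fin d)) β).indicator
      (weight (-α))) := by
    refine ⟨(continuous_weight _).measurable.indicator measurableSet_closedBall,
      Real.exp (α * β ^ 2), fun ξ => ?_⟩
    by_cases hξ : ξ ∈ Metric.closedBall (0 : EuclideanSpace ℝ (Fin d)) β
    · rw [indicator_of_mem hξ, abs_of_pos (weight_pos _ _), weight, Real.exp_le_exp]
      have := mem_closedBall_zero_iff.1 hξ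
      rw [neg_mul, neg_neg]
      gcongr
    · rw [indicator_of_notMem hξ, abs_zero]
      positivity
  set g : L2Space d := mulL2 volume hgm h with hg
  have hgn : ‖g‖ ≤ Real.exp (α * β ^ 2) * ‖h‖ := by
    refine Lp.norm_le_mul_norm_of_ae_le_mul ?_
    filter_upwards [coeFn_mulL2 hgm h] with ξ h1
    rw [h1, norm_mul, Complex.norm_real, Real.norm_eq_abs]
    gcongr
    by_cases hξ : ξ ∈ Metric.closedBall (0 : EuclideanSpace ℝ (Fin d)) β
    · rw [indicator_of_mem hξ, abs_of_pos (weight_pos _ _), weight, Real.exp_le_exp]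
      have := mem_closedBall_zero_iff.1 hξ
      rw [neg_mul, neg_neg]
      gcongr
    · rw [indicator_of_notMem hξ, abs_zero]
      positivity
  obtain ⟨b, hb, hbZ⟩ := hΨ g
  refine (norm_leastSquares_le ha b).trans ?_
  -- The competitor `b` reproduces `q` on `Z`, and `q` vanishes off `Z`; only the damped tail of `T
  -- b` remains.
  have h1 : (mulL2 volume (isMultiplier_weight hαn) ∘L Ψ) b - q =
      cutoff hZm.compl (mulL2 volume (isMultiplier_weight hαn) (Ψ b)) := by
    refine Lp.ext ?_
    filter_upwards [Lp.coeFn_sub ((mulL2 volume (isMultiplier_weight hαn) ∘L Ψ) b) q,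
      coeFn_cutoff hZm.compl (mulL2 volume (isMultiplier_weight hαn) (Ψ b)),
      coeFn_mulL2 (isMultiplier_weight hαn) (Ψ b), hq, hh, hbZ, coeFn_mulL2 hgm h]
      with ξ h1 h2 h3 h4 h5 h6 h7
    rw [h1, Pi.sub_apply, h2, h4, ContinuousLinearMap.comp_apply]
    by_cases hξ : ξ ∈ Z
    · rw [indicator_of_notMem (s := Zᶜ) (not_not_intro hξ), indicator_of_mem (s := Z) hξ, h3, h6 hξ, hg, h7]
      by_cases hξβ : ξ ∈ Metric.closedBall (0 : EuclideanSpace ℝ (Fin d)) β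
      · rw [indicator_of_mem hξβ, ← mul_assoc, ← mul_assoc, mul_assoc (weight _ ξ : ℂ),
          ofReal_weight_mul_weight, ofReal_weight_mul_weight, sub_eq_zero]
        congr 3
        ring
      · rw [h5 hξβ]; simp
    · rw [indicator_of_mem (s := Zᶜ) hξ, indicator_of_notMem (s := Z) hξ, sub_zero]
  rw [h1]
  refine (norm_cutoff_mulL2_weight_le hδ hαn hZm hδZ _).trans ?_
  gcongr
  exact hb.trans (by gcongr)

/-- The error on and off `Z` in terms of the residual. -/
theorem norm_cutoff_error_le (hδ : 0 ≤ δ) (hR : 0 ≤ R)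
    (hZm : MeasurableSet Z) (hδZ : Metric.closedBall 0 δ ⊆ Z)
    (hΨ : ∀ g : L2Space d, ∃ b, ‖Ψ b‖ ≤ R * ‖g‖ ∧
      ∀ᵐ ξ, ξ ∈ Z → Ψ b ξ = (weight (1 / 2) ξ : ℂ) * g ξ)
    (hαn : 0 ≤ (α - 1) / 2) (hα2 : 0 ≤ α / 2) {r : L2Space d}
    (hr : ∀ b, ⟪(mulL2 volume (isMultiplier_weight hαn) ∘L Ψ) b, r⟫_ℂ = 0) :
    ‖cutoff hZm (mulL2 volume (isMultiplier_weight hα2) r)‖ ≤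
      Real.exp (-((α - 1) / 2 * δ ^ 2)) * (R * ‖r‖) := by
  set p := cutoff hZm (mulL2 volume (isMultiplier_weight hα2) r) with hp
  -- With this `b`, `T b` is `weight (α/2) · p` on `Z` plus a tail off `Z`. Orthogonality to `r`
  -- then equates `‖p‖²` with minus the inner product of the tail and `r`.
  obtain ⟨b, hb, hbZ⟩ := hΨ p
  have h1 : (mulL2 volume (isMultiplier_weight hαn) ∘L Ψ) b =
      mulL2 volume (isMultiplier_weight hα2) p +
        cutoff hZm.compl (mulL2 volume (isMultiplier_weight hαn) (Ψ b)) := by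
    refine Lp.ext ?_
    filter_upwards [Lp.coeFn_add (mulL2 volume (isMultiplier_weight hα2) p)
      (cutoff hZm.compl (mulL2 volume (isMultiplier_weight hαn) (Ψ b))),
      coeFn_cutoff hZm.compl (mulL2 volume (isMultiplier_weight hαn) (Ψ b)),
      coeFn_mulL2 (isMultiplier_weight hαn) (Ψ b), coeFn_mulL2 (isMultiplier_weight hα2) p, hbZ,
      coeFn_cutoff hZm (mulL2 volume (isMultiplier_weight hα2) r)]
      with ξ h1 h2 h3 h4 h5 h6
    rw [h1, Pi.add_apply, h2, h4, ContinuousLinearMap.comp_apply]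
    by_cases hξ : ξ ∈ Z
    · rw [indicator_of_notMem (s := Zᶜ) (not_not_intro hξ), h3, h5 hξ, ← mul_assoc,
        ofReal_weight_mul_weight, add_zero]
      congr 3
      ring
    · rw [indicator_of_mem (s := Zᶜ) hξ, hp, h6, indicator_of_notMem hξ, mul_zero, zero_add]
  have h2 := hr b
  rw [h1, inner_add_left, inner_mulL2_left] at h2
  have h3 : ⟪p, mulL2 volume (isMultiplier_weight hα2) r⟫_ℂ = ((‖p‖ ^ 2 : ℝ) : ℂ) := by
    have h4 : ⟪p, mulL2 volume (isMultiplier_weight hα2) r⟫_ℂ = ⟪p, p⟫_ℂ := by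
      conv_lhs => rw [hp, ← cutoff_cutoff, ← hp, inner_cutoff_left]
    rw [h4, inner_self_eq_norm_sq_to_K]
    simp
  rw [h3, add_eq_zero_iff_eq_neg] at h2
  have h5 : ‖p‖ ^ 2 ≤ (Real.exp (-((α - 1) / 2 * δ ^ 2)) * (R * ‖p‖)) * ‖r‖ := by
    have h6 := congrArg norm h2
    rw [norm_neg, Complex.norm_real, Real.norm_of_nonneg (by positivity)] at h6
    rw [h6]
    refine (norm_inner_le_norm _ _).trans ?_
    gcongr
    exact (norm_cutoff_mulL2_weight_le hδ hαn hZm hδZ _).trans (by gcongr)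
  rcases (norm_nonneg p).eq_or_lt with h0 | h0
  · rw [← h0]; positivity
  · refine le_of_mul_le_mul_right ?_ h0
    linarith

/-- Cauchy-Schwarz. -/
theorem lintegral_weight_mul_le (f : L2Space d) :
    ∫⁻ ξ, ‖(weight (1 / 2) ξ : ℂ) * f ξ‖ₑ ≤
      eLpNorm (fun ξ : EuclideanSpace ℝ (Fin d) => (weight (1 / 2) ξ : ℂ)) 2 volume * ‖f‖ₑ := by
  rw [← eLpNorm_one_eq_lintegral_enorm, Lp.enorm_def]
  have h := (memLp_weight (d := d) (s := 1 / 2) (by norm_num)).1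
  have := eLpNorm_smul_le_mul_eLpNorm (p := 2) (q := 2) (r := 1) (μ := volume)
    (φ := fun ξ : EuclideanSpace ℝ (Fin d) => (weight (1 / 2) ξ : ℂ)) (f := (f : _ → ℂ))
    (Lp.aestronglyMeasurable f) h
  exact this

/-- On `Z` the factor `weight (1/2)` can be inserted at the cost of `exp(1/2)`; off `Z` it is split
from `weight (α/2)`, leaving the damping factor. Cauchy-Schwarz then turns `L₂` bounds into an `L₁`
bound. -/
theorem lintegral_error_le (hα : 1 ≤ α) (hδ : 0 ≤ δ)
    (hZm : MeasurableSet Z) (hδZ : Metric.closedBall 0 δ ⊆ Z) (hZ1 : Z ⊆ Metric.closedBall 0 1)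
    (hα2 : 0 ≤ α / 2) (r : L2Space d) :
    ∫⁻ ξ, ‖(weight (α / 2) ξ : ℂ) * r ξ‖ₑ ≤
      eLpNorm (fun ξ : EuclideanSpace ℝ (Fin d) => (weight (1 / 2) ξ : ℂ)) 2 volume *
        ENNReal.ofReal (Real.exp (1 / 2) *
          ‖cutoff hZm (mulL2 volume (isMultiplier_weight hα2) r)‖ +
          Real.exp (-((α - 1) / 2 * δ ^ 2)) * ‖r‖) := by
  have hαn : 0 ≤ (α - 1) / 2 := by linarith
  set p := cutoff hZm (mulL2 volume (isMultiplier_weight hα2) r) with hp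
  have h1 : ∀ᵐ ξ, ‖(weight (α / 2) ξ : ℂ) * r ξ‖ₑ ≤
      ENNReal.ofReal (Real.exp (1 / 2)) * ‖(weight (1 / 2) ξ : ℂ) * p ξ‖ₑ +
      ENNReal.ofReal (Real.exp (-((α - 1) / 2 * δ ^ 2))) * ‖(weight (1 / 2) ξ : ℂ) * r ξ‖ₑ := by
    filter_upwards [coeFn_cutoff hZm (mulL2 volume (isMultiplier_weight hα2) r),
      coeFn_mulL2 (isMultiplier_weight hα2) r] with ξ h1 h2
    simp only [← ofReal_norm]
    rw [← ENNReal.ofReal_mul (by positivity), ← ENNReal.ofReal_mul (by positivity),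
      ← ENNReal.ofReal_add (by positivity) (by positivity)]
    refine ENNReal.ofReal_le_ofReal ?_
    have hw : ∀ s, ‖(weight s ξ : ℂ)‖ = weight s ξ := fun s => by
      rw [Complex.norm_real, Real.norm_of_nonneg (weight_pos _ _).le]
    by_cases hξ : ξ ∈ Z
    · rw [hp, h1, indicator_of_mem hξ, h2]
      refine le_add_of_le_of_nonneg ?_ (by positivity)
      rw [norm_mul (weight (1 / 2) ξ : ℂ), ← mul_assoc, hw]
      refine le_mul_of_one_le_left (norm_nonneg _) ?_
      rw [weight, ← Real.exp_add]
      refine Real.one_le_exp ?_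
      have h5 := mem_closedBall_zero_iff.1 (hZ1 hξ)
      nlinarith [norm_nonneg ξ]
    · refine le_add_of_nonneg_of_le (by positivity) ?_
      rw [norm_mul, norm_mul, hw, hw, ← mul_assoc]
      gcongr
      have : weight (α / 2) ξ = weight ((α - 1) / 2) ξ * weight (1 / 2) ξ := by
        rw [weight_mul_weight]; congr 1; ring
      rw [this]
      refine mul_le_mul_of_nonneg_right (weight_le_of_le hαn hδ ?_) (weight_pos _ _).le
      by_contra hn
      exact hξ (hδZ (mem_closedBall_zero_iff.2 (le_of_not_ge hn)))
  refine (lintegral_mono_ae h1).trans ?_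
  rw [lintegral_add_left' ((integrable_weight_mul (by norm_num) p).1.enorm.const_mul _),
    lintegral_const_mul' _ _ ENNReal.ofReal_ne_top,
    lintegral_const_mul' _ _ ENNReal.ofReal_ne_top, ENNReal.ofReal_add (by positivity) (by positivity),
    ENNReal.ofReal_mul (by positivity), ENNReal.ofReal_mul (by positivity), ofReal_norm, ofReal_norm,
    mul_add]
  refine add_le_add ?_ ?_
  · rw [mul_left_comm]
    gcongr
    exact lintegral_weight_mul_le p
  · rw [mul_left_comm]
    gcongr
    exact lintegral_weight_mul_le r

end

/-! ### Well-posedness and the rate `exp(α(β² - δ²))` -/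

section

open scoped ComplexConjugate InnerProductSpace

variable {d : ℕ}

theorem synth_congr_ae {u v : EuclideanSpace ℝ (Fin d) → ℂ} (h : u =ᵐ[volume] v) :
    synth u = synth v := by
  funext t
  rw [synth, synth]
  congr 1
  refine integral_congr_ae ?_
  filter_upwards [h] with ξ hξ
  rw [hξ]

theorem enorm_synth_le (u : EuclideanSpace ℝ (Fin d) → ℂ) (t : EuclideanSpace ℝ (Fin d)) :
    ‖synth u t‖ₑ ≤ ∫⁻ ξ, ‖u ξ‖ₑ := by
  rw [synth, enorm_mul]
  have h1 : ‖(((2 * Real.pi) ^ (-(d : ℝ) / 2) : ℝ) : ℂ)‖ₑ ≤ 1 := by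
    rw [← ofReal_norm, Complex.norm_real, Real.norm_of_nonneg (by positivity), ENNReal.ofReal_le_one]
    refine Real.rpow_le_one_of_one_le_of_nonpos ?_ ?_
    · linarith [Real.pi_gt_three]
    · have : (0 : ℝ) ≤ d := d.cast_nonneg
      linarith
  refine (mul_le_mul_left h1 _).trans ?_
  rw [one_mul]
  refine (enorm_integral_le_lintegral_enorm _).trans (lintegral_mono fun ξ => ?_)
  rw [enorm_mul, ← conj_expo, ← ofReal_norm (conj _), RCLike.norm_conj, norm_expo,
    ENNReal.ofReal_one, one_mul]

/-- Functions in `PW_S`, `S ⊆ Z`, as data of a least squares problem. -/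
theorem exists_leastSquares_data {α : ℝ} (hα : 0 ≤ α) {S Z : Set (EuclideanSpace ℝ (Fin d))}
    (hSZ : S ⊆ Z) (hZm : MeasurableSet Z) (hZ1 : Z ⊆ Metric.closedBall 0 1)
    {f : EuclideanSpace ℝ (Fin d) → ℂ} (hf : f ∈ paleyWiener S) :
    ∃ h q : L2Space d, ‖h‖ₑ = eLpNorm f 2 volume ∧ (∀ᵐ ξ, ξ ∉ S → h ξ = 0) ∧
      q =ᵐ[volume] (fun ξ => Z.indicator (fun ξ => (weight (-(α / 2)) ξ : ℂ) * h ξ) ξ) ∧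
      f = synth fun ξ => (weight (α / 2) ξ : ℂ) * q ξ := by
  obtain ⟨h, hm, -, hn, h0, hfs⟩ :=
    exists_eq_synth_of_mem_paleyWiener (Metric.isBounded_closedBall.subset (hSZ.trans hZ1)) hf
  have hw : IsMultiplier (Z.indicator (weight (-(α / 2)))) := by
    refine ⟨(continuous_weight _).measurable.indicator hZm, Real.exp (α / 2), fun ξ => ?_⟩
    by_cases hξ : ξ ∈ Z
    · rw [indicator_of_mem hξ, abs_of_pos (weight_pos _ _), weight, Real.exp_le_exp]
      have h1 := mem_closedBall_zero_iff.1 (hZ1 hξ)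
      have h2 : ‖ξ‖ ^ 2 ≤ 1 := pow_le_one₀ (norm_nonneg _) h1
      nlinarith
    · rw [indicator_of_notMem hξ, abs_zero]
      positivity
  have hh := hm.coeFn_toLp
  have hq : mulL2 volume hw (hm.toLp h) =ᵐ[volume]
      (fun ξ => Z.indicator (fun ξ => (weight (-(α / 2)) ξ : ℂ) * hm.toLp h ξ) ξ) := by
    filter_upwards [coeFn_mulL2 hw (hm.toLp h)] with ξ h1
    rw [h1]
    by_cases hξ : ξ ∈ Z <;> simp [hξ]
  refine ⟨hm.toLp h, mulL2 volume hw (hm.toLp h), ?_, ?_, hq, ?_⟩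
  · rw [Lp.enorm_def, eLpNorm_congr_ae hh, hn]
  · filter_upwards [hh, h0] with ξ h1 h2 hξ
    rw [h1, h2 hξ]
  · rw [hfs]
    refine synth_congr_ae ?_
    filter_upwards [hq, hh, h0] with ξ h1 h2 h3
    rw [h1]
    by_cases hξ : ξ ∈ Z
    · rw [indicator_of_mem hξ, ← mul_assoc, ofReal_weight_mul_weight, h2, add_neg_cancel,
        weight_zero, Complex.ofReal_one, one_mul]
    · rw [indicator_of_notMem hξ, mul_zero, h3 fun h => hξ (hSZ h)]

/-- On `Z ⊆ B₂` the weight is at least `exp(-s)`. The constant degenerates as `s` grows, but it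
serves only for solvability and does not enter the error bounds. -/
theorem bounded_below_of_mulL2_weight {R s : ℝ} (hR : 0 < R) (hs : 0 ≤ s)
    {Z : Set (EuclideanSpace ℝ (Fin d))} (hZ1 : Z ⊆ Metric.closedBall 0 1)
    {Ψ : EllTwo →L[ℂ] L2Space d}
    (hΨ : ∀ (a : EllTwo) (g : L2Space d), (∀ᵐ ξ, ξ ∈ Z → ‖Ψ a ξ‖ ≤ ‖g ξ‖) → ‖a‖ ≤ R * ‖g‖)
    (a : EllTwo) :
    (R * Real.exp s)⁻¹ * ‖a‖ ≤ ‖(mulL2 volume (isMultiplier_weight hs) ∘L Ψ) a‖ := by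
  set T := mulL2 volume (isMultiplier_weight hs) ∘L Ψ
  have h := hΨ a ((Real.exp s : ℂ) • T a) ?_
  · rw [norm_smul, Complex.norm_real, Real.norm_of_nonneg (Real.exp_pos _).le]
      at h
    rw [inv_mul_le_iff₀ (by positivity)]
    linarith
  · filter_upwards [Lp.coeFn_smul (Real.exp s : ℂ) (T a),
      coeFn_mulL2 (isMultiplier_weight hs) (Ψ a)] with ξ h1 h2 hξ
    rw [h1, Pi.smul_apply, ContinuousLinearMap.comp_apply, h2, norm_smul, norm_mul, Complex.norm_real,
      Complex.norm_real, Real.norm_of_nonneg (Real.exp_pos _).le,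
      Real.norm_of_nonneg (weight_pos _ _).le, ← mul_assoc, weight, ← Real.exp_add]
    refine le_mul_of_one_le_left (norm_nonneg _) (Real.one_le_exp ?_)
    have h3 : ‖ξ‖ ^ 2 ≤ 1 := pow_le_one₀ (norm_nonneg _) (mem_closedBall_zero_iff.1 (hZ1 hξ))
    nlinarith

theorem synth_weight_mul_sub {s : ℝ} (hs : 0 < s) (r q : L2Space d) :
    synth (fun ξ => (weight s ξ : ℂ) * r ξ) - synth (fun ξ => (weight s ξ : ℂ) * q ξ) =
      synth (fun ξ => (weight s ξ : ℂ) * (r - q) ξ) := by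
  funext t
  rw [Pi.sub_apply, synth_weight_mul hs, synth_weight_mul hs, synth_weight_mul hs, inner_sub_right]
  ring

theorem memLp_synth_weight_mul {s : ℝ} (hs : 0 < s) (r : L2Space d) :
    MemLp (synth fun ξ => (weight s ξ : ℂ) * r ξ) 2 volume ∧
      eLpNorm (synth fun ξ => (weight s ξ : ℂ) * r ξ) 2 volume =
        ‖mulL2 volume (isMultiplier_weight hs.le) r‖ₑ := by
  have h := memLp_synth (integrable_weight_mul hs r)
    ((isMultiplier_weight hs.le).memLp (Lp.memLp r))
  refine ⟨h.1, ?_⟩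
  rw [h.2, Lp.enorm_def]
  exact (eLpNorm_congr_ae (coeFn_mulL2 _ r)).symm

variable {δ β : ℝ} {Z : Set (EuclideanSpace ℝ (Fin d))} {x : ℕ → EuclideanSpace ℝ (Fin d)}

theorem interpolation_wellDefined (hδ : 0 < δ) (hδ1 : δ ≤ 1) (hZm : MeasurableSet Z)
    (hδZ : Metric.closedBall 0 δ ⊆ Z) (hZ1 : Z ⊆ Metric.closedBall 0 1)
    (hx : IsRieszBasisSequence Z x) {α : ℝ} (hα : 1 ≤ α) {f : EuclideanSpace ℝ (Fin d) → ℂ}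
    (hf : f ∈ paleyWiener Z) :
    (∃! a : EllTwo, SolvesInterpolation (gaussian α) x f a) ∧
      (∀ t, Summable fun j => interpolationCoeff (gaussian α) x f j * (gaussian α (t - x j) : ℂ)) ∧
      MemLp (interpolant (gaussian α) x f) 2 volume := by
  have hα0 : 0 < α := by linarith
  have hαn : 0 ≤ (α - 1) / 2 := by linarith
  obtain ⟨Ψ, R, hR, hΨ, hΨ1, -⟩ := exists_synthesis_of_isRieszBasisSequence hδ hδ1 hZm hδZ hZ1 hx
  have hT := hΨ.mulL2_comp hαn
  rw [show (α - 1) / 2 + 1 / 2 = α / 2 by ring] at hT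
  obtain ⟨h, q, -, -, -, hfq⟩ := exists_leastSquares_data hα0.le Subset.rfl hZm hZ1 hf
  obtain ⟨h1, a, -, h2⟩ := existsUnique_solvesInterpolation hα0 hT (by positivity)
    (bounded_below_of_mulL2_weight hR hαn hZ1 hΨ1) hfq
  refine ⟨h1, fun t => (hasSum_gaussian hα0 hT _ t).summable, ?_⟩
  rw [h2]
  exact (memLp_synth_weight_mul (half_pos hα0) _).1

theorem exists_interpolation_error_le (hδ : 0 < δ) (hδ1 : δ ≤ 1) (hβδ : β ≤ δ)
    (hZm : MeasurableSet Z) (hδZ : Metric.closedBall 0 δ ⊆ Z) (hZ1 : Z ⊆ Metric.closedBall 0 1)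
    (hx : IsRieszBasisSequence Z x) :
    ∃ C : ℝ, 0 < C ∧ ∀ f ∈ paleyWiener (Metric.closedBall (0 : EuclideanSpace ℝ (Fin d)) β),
      ∀ α : ℝ, 1 ≤ α →
        eLpNorm (interpolant (gaussian α) x f - f) 2 volume ≤
          ENNReal.ofReal (C * Real.exp (α * (β ^ 2 - δ ^ 2))) * eLpNorm f 2 volume ∧
        ∀ t, ‖interpolant (gaussian α) x f t - f t‖ₑ ≤
          ENNReal.ofReal (C * Real.exp (α * (β ^ 2 - δ ^ 2))) * eLpNorm f 2 volume := by
  obtain ⟨Ψ, R, hR, hΨ, hΨ1, hΨ2⟩ :=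
    exists_synthesis_of_isRieszBasisSequence hδ hδ1 hZm hδZ hZ1 hx
  set W := eLpNorm (fun ξ : EuclideanSpace ℝ (Fin d) => (weight (1 / 2) ξ : ℂ)) 2 volume with hW
  have hWtop : W ≠ ⊤ := (memLp_weight (by norm_num)).2.ne
  -- `R + 1` comes from the `L₂` bound and the `W` term from the uniform bound; `R exp(δ²)` is what
  -- remains of `‖r‖` and of the two factors `A`, as `A² = exp(δ²) exp(-αδ²)`.
  refine ⟨(R + 1 + W.toReal * (Real.exp (1 / 2) * R + 1)) * (R * Real.exp (δ ^ 2)),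
    by positivity, fun f hf α hα => ?_⟩
  have hα0 : 0 < α := by linarith
  have hαn : 0 ≤ (α - 1) / 2 := by linarith
  have hα2 : 0 ≤ α / 2 := by linarith
  have hT := hΨ.mulL2_comp hαn
  rw [show (α - 1) / 2 + 1 / 2 = α / 2 by ring] at hT
  obtain ⟨h, q, hh, h0, hq, hfq⟩ := exists_leastSquares_data hα0.le
    ((Metric.closedBall_subset_closedBall hβδ).trans hδZ) hZm hZ1 hf
  obtain ⟨-, a, ha, h2⟩ := existsUnique_solvesInterpolation hα0 hT (by positivity)
    (bounded_below_of_mulL2_weight hR hαn hZ1 hΨ1) hfq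
  have hr := norm_residual_le hα hδ.le hR.le hZm hδZ hΨ2 hαn hq h0 ha
  set r := (mulL2 volume (isMultiplier_weight hαn) ∘L Ψ) a - q with hrdef
  have hp := norm_cutoff_error_le hδ.le hR.le hZm hδZ hΨ2 hαn hα2 ha
  have hl := lintegral_error_le hα hδ.le hZm hδZ hZ1 hα2 r
  set p := cutoff hZm (mulL2 volume (isMultiplier_weight hα2) r) with hpdef
  set A := Real.exp (-((α - 1) / 2 * δ ^ 2)) with hA
  have herr : interpolant (gaussian α) x f - f = synth fun ξ => (weight (α / 2) ξ : ℂ) * r ξ := by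
    rw [h2]
    conv_lhs => rw [hfq]
    exact synth_weight_mul_sub (half_pos hα0) _ _
  have hAr : A * ‖r‖ ≤ R * Real.exp (δ ^ 2) * Real.exp (α * (β ^ 2 - δ ^ 2)) * ‖h‖ := by
    calc A * ‖r‖ ≤ A * (A * (R * (Real.exp (α * β ^ 2) * ‖h‖))) := by gcongr
      _ = R * (A * A * Real.exp (α * β ^ 2)) * ‖h‖ := by ring
      _ = R * (Real.exp (δ ^ 2) * Real.exp (α * (β ^ 2 - δ ^ 2))) * ‖h‖ := by
          rw [hA, ← Real.exp_add, ← Real.exp_add, ← Real.exp_add]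
          congr 3
          ring
      _ = _ := by ring
  have hu : ‖mulL2 volume (isMultiplier_weight hα2) r‖ ≤ (R + 1) * (A * ‖r‖) := by
    rw [← cutoff_add_cutoff_compl hZm (mulL2 volume (isMultiplier_weight hα2) r)]
    refine (norm_add_le _ _).trans ?_
    have h3 := norm_cutoff_mulL2_weight_le hδ.le hα2 hZm hδZ r
    have h4 : Real.exp (-(α / 2 * δ ^ 2)) ≤ A := by
      rw [hA, Real.exp_le_exp]
      nlinarith [sq_nonneg δ]
    have h5 : Real.exp (-(α / 2 * δ ^ 2)) * ‖r‖ ≤ A * ‖r‖ := by gcongr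
    linarith
  have hl1 : Real.exp (1 / 2) * ‖p‖ + A * ‖r‖ ≤ (Real.exp (1 / 2) * R + 1) * (A * ‖r‖) := by
    have : Real.exp (1 / 2) * ‖p‖ ≤ Real.exp (1 / 2) * (A * (R * ‖r‖)) := by gcongr
    linarith
  have hWn : 0 ≤ W.toReal := ENNReal.toReal_nonneg
  have he : 0 < Real.exp (1 / 2) := Real.exp_pos _
  have hfin : ∀ c, 0 ≤ c → c ≤ R + 1 + W.toReal * (Real.exp (1 / 2) * R + 1) →
      ENNReal.ofReal (c * (A * ‖r‖)) ≤ ENNReal.ofReal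
        ((R + 1 + W.toReal * (Real.exp (1 / 2) * R + 1)) * (R * Real.exp (δ ^ 2)) *
          Real.exp (α * (β ^ 2 - δ ^ 2))) * eLpNorm f 2 volume := by
    intro c hc hcle
    rw [← hh, ← ofReal_norm, ← ENNReal.ofReal_mul (by positivity)]
    refine ENNReal.ofReal_le_ofReal ?_
    calc c * (A * ‖r‖) ≤ (R + 1 + W.toReal * (Real.exp (1 / 2) * R + 1)) *
          (R * Real.exp (δ ^ 2) * Real.exp (α * (β ^ 2 - δ ^ 2)) * ‖h‖) := by gcongr
      _ = _ := by ring
  refine ⟨?_, fun t => ?_⟩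
  · rw [herr, (memLp_synth_weight_mul (half_pos hα0) r).2, ← ofReal_norm]
    refine (ENNReal.ofReal_le_ofReal hu).trans (hfin _ (by positivity) ?_)
    have : 0 ≤ W.toReal * (Real.exp (1 / 2) * R + 1) := by positivity
    linarith
  · rw [← Pi.sub_apply, herr]
    refine (enorm_synth_le _ t).trans (hl.trans ?_)
    have hWe : eLpNorm (fun ξ : EuclideanSpace ℝ (Fin d) => (weight (1 / 2) ξ : ℂ)) 2 volume =
        ENNReal.ofReal W.toReal := (ENNReal.ofReal_toReal hWtop).symm
    rw [hWe, ← ENNReal.ofReal_mul hWn]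
    refine le_trans (ENNReal.ofReal_le_ofReal ?_)
      (hfin (W.toReal * (Real.exp (1 / 2) * R + 1)) (by positivity) (by linarith))
    rw [mul_assoc]
    gcongr

end

/-! ### Regularity of the Gaussian family -/

section

variable {d : ℕ}

theorem hat_gaussian {α : ℝ} (hα : 0 < α) (ξ : EuclideanSpace ℝ (Fin d)) :
    hat (gaussian α) ξ = (((2 * α) ^ ((d : ℝ) / 2) * weight α ξ : ℝ) : ℂ) := by
  have h := GaussianFourier.integral_cexp_neg_mul_sq_norm_add (b := (((4 * α)⁻¹ : ℝ) : ℂ))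
    (by rw [Complex.ofReal_re]; positivity) (-Complex.I) ξ
  rw [finrank_euclideanSpace_fin] at h
  have h2 : ∫ v : EuclideanSpace ℝ (Fin d), (gaussian α v : ℂ) *
      Complex.exp (-(Complex.I * ((inner ℝ ξ v : ℝ) : ℂ))) =
      ∫ v, Complex.exp (-(((4 * α)⁻¹ : ℝ) : ℂ) * (‖v‖ : ℂ) ^ 2 +
        -Complex.I * ((inner ℝ ξ v : ℝ) : ℂ)) := by
    refine integral_congr_ae (Eventually.of_forall fun v => ?_)
    simp only
    rw [gaussian, Complex.ofReal_exp, ← Complex.exp_add]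
    congr 1
    push_cast
    ring
  have h3 : ((Real.pi : ℂ) / (((4 * α)⁻¹ : ℝ) : ℂ)) ^ ((d : ℂ) / 2) =
      (((4 * α * Real.pi) ^ ((d : ℝ) / 2) : ℝ) : ℂ) := by
    rw [← Complex.ofReal_div, Complex.ofReal_cpow (by positivity)]
    congr 1
    · push_cast; rw [div_inv_eq_mul]; ring
    · push_cast; rfl
  have h4 : (-Complex.I) ^ 2 * (‖ξ‖ : ℂ) ^ 2 / (4 * (((4 * α)⁻¹ : ℝ) : ℂ)) =
      ((-(α * ‖ξ‖ ^ 2) : ℝ) : ℂ) := by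
    rw [neg_sq, Complex.I_sq]
    push_cast
    have : (α : ℂ) ≠ 0 := by exact_mod_cast hα.ne'
    field_simp
  have h5 : (2 * Real.pi)⁻¹ * (4 * α * Real.pi) = 2 * α := by
    field_simp
    ring
  rw [hat, fourierL1, h2, h, h3, h4, ← Complex.ofReal_exp, ← Complex.ofReal_mul,
    ← Complex.ofReal_mul, weight, ← mul_assoc, neg_div, Real.rpow_neg (by positivity),
    ← Real.inv_rpow (by positivity), ← Real.mul_rpow (by positivity) (by positivity), h5]

theorem enorm_hat_gaussian {α : ℝ} (hα : 0 < α) (ξ : EuclideanSpace ℝ (Fin d)) :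
    ‖hat (gaussian α) ξ‖ₑ = ENNReal.ofReal ((2 * α) ^ ((d : ℝ) / 2) * weight α ξ) := by
  rw [hat_gaussian hα, ← ofReal_norm, Complex.norm_real,
    Real.norm_of_nonneg (mul_nonneg (by positivity) (weight_pos _ _).le)]

theorem le_weight_of_norm_le {s r : ℝ} (hs : 0 ≤ s) {ξ : EuclideanSpace ℝ (Fin d)}
    (h : ‖ξ‖ ≤ r) : Real.exp (-(s * r ^ 2)) ≤ weight s ξ := by
  rw [weight]
  gcongr

theorem annulusSup_gaussian_le {α δ : ℝ} (hα : 0 < α) (hδ : 0 ≤ δ) :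
    annulusSup (d := d) δ (gaussian α) ≤
      ENNReal.ofReal ((2 * α) ^ ((d : ℝ) / 2) * Real.exp (-(α * δ ^ 2))) := by
  refine iSup₂_le fun u hu => ?_
  rw [enorm_hat_gaussian hα]
  refine ENNReal.ofReal_le_ofReal ?_
  gcongr
  refine weight_le_of_le hα.le hδ ?_
  by_contra hn
  exact hu.2 (mem_closedBall_zero_iff.2 (le_of_not_ge hn))

/-- The annulus omits the sphere of radius `δ`, so the value there is reached only as a limit of
radii `r ↓ δ`. Vectors of every such norm exist because `d ≥ 1`. -/
theorem le_annulusSup_gaussian (hd : 1 ≤ d) {α δ : ℝ} (hα : 0 < α) (hδ : 0 ≤ δ) (hδ1 : δ < 1) :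
    ENNReal.ofReal ((2 * α) ^ ((d : ℝ) / 2) * Real.exp (-(α * δ ^ 2))) ≤
      annulusSup (d := d) δ (gaussian α) := by
  have : Nonempty (Fin d) := ⟨⟨0, hd⟩⟩
  have hc : Continuous fun r : ℝ =>
      ENNReal.ofReal ((2 * α) ^ ((d : ℝ) / 2) * Real.exp (-(α * r ^ 2))) :=
    ENNReal.continuous_ofReal.comp (by fun_prop)
  refine le_of_tendsto (hc.continuousWithinAt (s := Ioi δ) (x := δ)) ?_
  filter_upwards [Ioo_mem_nhdsGT hδ1] with r hr
  obtain ⟨u, hu⟩ := exists_norm_eq (EuclideanSpace ℝ (Fin d)) (hδ.trans hr.1.le)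
  have hmem : u ∈ Metric.closedBall (0 : EuclideanSpace ℝ (Fin d)) 1 \ Metric.closedBall 0 δ :=
    ⟨mem_closedBall_zero_iff.2 (hu.trans_le hr.2.le),
      fun h => (mem_closedBall_zero_iff.1 h).not_gt (hu ▸ hr.1)⟩
  refine le_trans (le_of_eq ?_) (le_iSup₂ (f := fun u _ => ‖hat (gaussian α) u‖ₑ) u hmem)
  rw [enorm_hat_gaussian hα, weight, hu]

theorem le_ballInf_gaussian {α r : ℝ} (hα : 0 < α) :
    ENNReal.ofReal ((2 * α) ^ ((d : ℝ) / 2) * Real.exp (-(α * r ^ 2))) ≤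
      ballInf (d := d) r (gaussian α) := by
  refine le_iInf₂ fun u hu => ?_
  rw [enorm_hat_gaussian hα]
  refine ENNReal.ofReal_le_ofReal ?_
  gcongr
  exact le_weight_of_norm_le hα.le (mem_closedBall_zero_iff.1 hu)

theorem dyadicSup_gaussian_le {α δ : ℝ} (hα : 1 ≤ α) (hδ : 0 ≤ δ)
    {Z : Set (EuclideanSpace ℝ (Fin d))} (hδZ : Metric.closedBall 0 δ ⊆ Z) (j : ℕ) :
    dyadicSup Z (gaussian α) (j + 1) ≤
      ENNReal.ofReal ((2 * α) ^ ((d : ℝ) / 2) * Real.exp (-(α * δ ^ 2))) *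
        ENNReal.ofReal (Real.exp (δ ^ 2) * Real.exp (-(4 ^ j * δ ^ 2))) := by
  have hα0 : 0 < α := by linarith
  refine iSup₂_le fun u hu => ?_
  rw [enorm_hat_gaussian hα0, ← ENNReal.ofReal_mul (by positivity), mul_assoc]
  refine ENNReal.ofReal_le_ofReal ?_
  gcongr
  -- Since `u ∉ ½Z`, the point `2u` lies outside `Z` and hence outside `δB₂`.
  have hu2 : δ ≤ ‖(2 : ℝ) • u‖ := by
    by_contra hn
    refine hu.2 ⟨(2 : ℝ) • u, hδZ (mem_closedBall_zero_iff.2 (le_of_not_ge hn)), ?_⟩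
    simp [smul_smul]
  have hu3 : 2 ^ j * δ ≤ ‖(2 : ℝ) ^ (j + 1) • u‖ := by
    rw [pow_succ, mul_smul, norm_smul, Real.norm_of_nonneg (by positivity)]
    gcongr
  refine (weight_le_of_le hα0.le (by positivity) hu3).trans ?_
  rw [← Real.exp_add, ← Real.exp_add, Real.exp_le_exp, mul_pow, ← pow_mul, mul_comm j, pow_mul]
  norm_num
  have h4 : (1 : ℝ) ≤ 4 ^ j := one_le_pow₀ (by norm_num)
  -- The exponents compare through `(α - 1)(4^j - 1)δ² ≥ 0`, which separates `α` from `j`.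
  nlinarith [mul_nonneg (mul_nonneg (sub_nonneg.2 hα) (sub_nonneg.2 h4)) (sq_nonneg δ)]

theorem tsum_dyadic_ne_top (hd : 1 ≤ d) {δ : ℝ} (hδ : 0 < δ) :
    ∑' j : ℕ, (2 : ℝ≥0∞) ^ (((j + 1 : ℕ) : ℝ) * (d : ℝ) / 2) *
      ENNReal.ofReal (Real.exp (δ ^ 2) * Real.exp (-(4 ^ j * δ ^ 2))) ≠ ⊤ := by
  -- From `exp(-y) ≤ d!/y^d` at `y = 4^j δ²`: the decay `4^(-jd)` outweighs the growth, at most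
  -- `2^((j+1)d)`, and leaves a geometric series.
  set c : ℝ := Real.exp (δ ^ 2) * 2 ^ d * (d.factorial / (δ ^ 2) ^ d) with hc
  have hsum : Summable fun j : ℕ => c * (1 / 2 : ℝ) ^ j := summable_geometric_two.mul_left c
  refine ne_top_of_le_ne_top hsum.tsum_ofReal_ne_top (ENNReal.tsum_le_tsum fun j => ?_)
  have h1 : (2 : ℝ≥0∞) ^ (((j + 1 : ℕ) : ℝ) * (d : ℝ) / 2) ≤ ENNReal.ofReal (2 ^ ((j + 1) * d)) := by
    rw [ENNReal.ofReal_pow (by norm_num), ENNReal.ofReal_ofNat, ← ENNReal.rpow_natCast]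
    refine ENNReal.rpow_le_rpow_of_exponent_le (by norm_num) ?_
    push_cast
    refine half_le_self ?_
    positivity
  have h2 : Real.exp (-(4 ^ j * δ ^ 2)) ≤ d.factorial / (δ ^ 2) ^ d * (1 / 4 ^ (j * d)) := by
    have h3 := Real.pow_div_factorial_le_exp (x := 4 ^ j * δ ^ 2) (by positivity) d
    rw [Real.exp_neg]
    calc (Real.exp (4 ^ j * δ ^ 2))⁻¹ ≤ ((4 ^ j * δ ^ 2) ^ d / d.factorial)⁻¹ := by gcongr
      _ = _ := by rw [inv_div, mul_pow, ← pow_mul]; field_simp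
  refine (mul_le_mul_left h1 _).trans ?_
  rw [← ENNReal.ofReal_mul (by positivity)]
  refine ENNReal.ofReal_le_ofReal ?_
  have h5 : (1 / 2 : ℝ) ^ (j * d) ≤ (1 / 2) ^ j :=
    pow_le_pow_of_le_one (by norm_num) (by norm_num) (Nat.le_mul_of_pos_right j hd)
  have h6 : (2 : ℝ) ^ (j * d) * (1 / 4 ^ (j * d)) = (1 / 2) ^ (j * d) := by
    rw [mul_one_div, ← div_pow]
    norm_num
  calc (2 : ℝ) ^ ((j + 1) * d) * (Real.exp (δ ^ 2) * Real.exp (-(4 ^ j * δ ^ 2)))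
      ≤ 2 ^ ((j + 1) * d) * (Real.exp (δ ^ 2) *
          (d.factorial / (δ ^ 2) ^ d * (1 / 4 ^ (j * d)))) := by gcongr
    _ = c * (2 ^ (j * d) * (1 / 4 ^ (j * d))) := by
        rw [hc, add_mul, one_mul, pow_add]; ring
    _ ≤ c * (1 / 2) ^ j := by
        rw [h6]
        gcongr

/-- The sum of dyadic suprema of a Gaussian is comparable with the value at radius `δ`. -/
theorem exists_dyadicSum_gaussian_le (hd : 1 ≤ d) {δ : ℝ} (hδ : 0 < δ)
    {Z : Set (EuclideanSpace ℝ (Fin d))} (hδZ : Metric.closedBall 0 δ ⊆ Z) :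
    ∃ C : ℝ≥0, ∀ α : ℝ, 1 ≤ α → dyadicSum Z (gaussian α) ≤
      C * ENNReal.ofReal ((2 * α) ^ ((d : ℝ) / 2) * Real.exp (-(α * δ ^ 2))) := by
  refine ⟨(∑' j : ℕ, (2 : ℝ≥0∞) ^ (((j + 1 : ℕ) : ℝ) * (d : ℝ) / 2) *
      ENNReal.ofReal (Real.exp (δ ^ 2) * Real.exp (-(4 ^ j * δ ^ 2)))).toNNReal, fun α hα => ?_⟩
  rw [ENNReal.coe_toNNReal (tsum_dyadic_ne_top hd hδ), ← ENNReal.tsum_mul_right]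
  refine ENNReal.tsum_le_tsum fun j => ?_
  rw [mul_assoc]
  refine mul_le_mul_right ((dyadicSup_gaussian_le hα hδ.le hδZ j).trans_eq (mul_comm _ _)) _

theorem isInterpolator_gaussian (hd : 1 ≤ d) {α δ : ℝ} (hα : 1 ≤ α) (hδ : 0 < δ)
    {Z : Set (EuclideanSpace ℝ (Fin d))} (hδZ : Metric.closedBall 0 δ ⊆ Z)
    (hZ1 : Z ⊆ Metric.closedBall 0 1) : IsInterpolator Z (gaussian α) := by
  have hα0 : 0 < α := by linarith
  have hg : (gaussian α : EuclideanSpace ℝ (Fin d) → ℝ) = weight (4 * α)⁻¹ := by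
    funext ξ
    rw [gaussian, weight]
    ring_nf
  have hh : hat (gaussian α) = fun ξ : EuclideanSpace ℝ (Fin d) =>
      (((2 * α) ^ ((d : ℝ) / 2) * weight α ξ : ℝ) : ℂ) := funext (hat_gaussian hα0)
  refine ⟨?_, ?_, ?_, fun ξ => ?_, ?_, ?_⟩
  · rw [hg]; exact integrable_weight (by positivity)
  · rw [hg]; exact continuous_weight _
  · rw [hh]; exact ((integrable_weight hα0).const_mul _).ofReal
  · rw [hat_gaussian hα0]
    refine ⟨Complex.ofReal_im _, ?_⟩
    rw [Complex.ofReal_re]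
    exact mul_nonneg (by positivity) (weight_pos _ _).le
  · refine ⟨(2 * α) ^ ((d : ℝ) / 2) * Real.exp (-(α * 1 ^ 2)), by positivity, fun ξ hξ => ?_⟩
    rw [hat_gaussian hα0, Complex.ofReal_re]
    gcongr
    exact le_weight_of_norm_le hα0.le (mem_closedBall_zero_iff.1 (hZ1 hξ))
  · obtain ⟨C, hC⟩ := exists_dyadicSum_gaussian_le hd hδ hδZ
    exact (hC α hα).trans_lt (ENNReal.mul_lt_top ENNReal.coe_lt_top ENNReal.ofReal_lt_top)

theorem tendsto_ofReal_exp_mul {k : ℝ} (hk : k < 0) (C : ℝ) :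
    Tendsto (fun α : ℝ => ENNReal.ofReal (C * Real.exp (α * k))) atTop (𝓝 0) := by
  have h := (Real.tendsto_exp_atBot.comp (tendsto_id.atTop_mul_const_of_neg hk)).const_mul C
  rw [mul_zero] at h
  simpa using ENNReal.tendsto_ofReal h

/-- The Gaussians form a regular family of interpolators. -/
theorem isRegularFamily_gaussian (hd : 1 ≤ d) {δ β : ℝ} (hδ : 0 < δ) (hδ1 : δ < 1)
    (hβ : β ^ 2 + 2 - 3 * δ ^ 2 < 0)
    {Z : Set (EuclideanSpace ℝ (Fin d))} (hδZ : Metric.closedBall 0 δ ⊆ Z)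
    (hZ1 : Z ⊆ Metric.closedBall 0 1) : IsRegularFamily Z δ β (Ici 1) gaussian := by
  have hev : ∀ᶠ α : ℝ in atTop ⊓ 𝓟 (Ici 1), 1 ≤ α :=
    eventually_inf_principal.2 (Eventually.of_forall fun α h => h)
  refine ⟨fun α hα => mem_Ioi.2 (lt_of_lt_of_le one_pos hα), not_bddAbove_Ici 1,
    fun α hα => isInterpolator_gaussian hd hα hδ hδZ hZ1, ?_, ?_⟩
  · obtain ⟨C, hC⟩ := exists_dyadicSum_gaussian_le hd hδ hδZ
    refine ⟨C, hev.mono fun α hα => (hC α hα).trans ?_⟩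
    gcongr
    exact le_annulusSup_gaussian hd (by linarith) hδ.le hδ1
  · refine tendsto_of_tendsto_of_tendsto_of_le_of_le' tendsto_const_nhds
      ((tendsto_ofReal_exp_mul hβ 1).mono_left inf_le_left) (Eventually.of_forall fun _ => zero_le)
      (hev.mono fun α hα => ?_)
    have hα0 : 0 < α := by linarith
    refine (ENNReal.div_le_div (pow_le_pow_left' (annulusSup_gaussian_le hα0 hδ.le) 3)
      (mul_le_mul' (le_ballInf_gaussian hα0)
        (pow_le_pow_left' (le_ballInf_gaussian hα0) 2))).trans ?_
    rw [← ENNReal.ofReal_pow (by positivity), ← ENNReal.ofReal_pow (by positivity),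
      ← ENNReal.ofReal_mul (by positivity), ← ENNReal.ofReal_div_of_pos (by positivity)]
    refine ENNReal.ofReal_le_ofReal (le_of_eq ?_)
    rw [div_eq_iff (by positivity), one_mul]
    set c := (2 * α) ^ ((d : ℝ) / 2)
    -- The powers `c³` cancel in the quotient, which leaves the exponent `β² + 2 - 3δ²`.
    calc (c * Real.exp (-(α * δ ^ 2))) ^ 3 = c ^ 3 * (Real.exp (-(α * δ ^ 2))) ^ 3 := by ring
      _ = c ^ 3 * (Real.exp (α * (β ^ 2 + 2 - 3 * δ ^ 2)) * (Real.exp (-(α * β ^ 2)) *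
          Real.exp (-(α * 1 ^ 2)) ^ 2)) := by
        rw [← Real.exp_nat_mul, ← Real.exp_nat_mul, ← Real.exp_add, ← Real.exp_add]
        congr 2
        push_cast
        ring
      _ = _ := by ring

end

end BandInterp

end

/-! ### The theorem -/

theorem mainTheorem5 (d : ℕ) (hd : 1 ≤ d) (δ β : ℝ)
    (hδ : δ ∈ Set.Ioo (Real.sqrt (2 / 3)) 1)
    (hβ : β ∈ Set.Ioo 0 (Real.sqrt (3 * δ ^ 2 - 2)))
    (Z : Set (EuclideanSpace ℝ (Fin d))) (hZ : BandInterp.IsSymmetricConvexBody Z)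
    (hδZ : Metric.closedBall 0 δ ⊆ Z) (hZ1 : Z ⊆ Metric.closedBall 0 1) :
    -- the Gaussians form a regular family
    BandInterp.IsRegularFamily Z δ β (Set.Ici 1) BandInterp.gaussian ∧
    ∀ x : ℕ → EuclideanSpace ℝ (Fin d), BandInterp.IsRieszBasisSequence Z x →
      -- the interpolation operators are well defined on `PW_Z`
      (∀ α : ℝ, 1 ≤ α → ∀ f ∈ BandInterp.paleyWiener Z,
        (∃! a : lp (fun _ : ℕ => ℂ) 2,
          BandInterp.SolvesInterpolation (BandInterp.gaussian α) x f a) ∧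
        (∀ t, Summable fun j => BandInterp.interpolationCoeff (BandInterp.gaussian α) x f j *
          (BandInterp.gaussian α (t - x j) : ℂ)) ∧
        MeasureTheory.MemLp (BandInterp.interpolant (BandInterp.gaussian α) x f) 2
          MeasureTheory.volume) ∧
      -- convergence in `L₂` and uniformly
      (∀ f ∈ BandInterp.paleyWiener (Metric.closedBall (0 : EuclideanSpace ℝ (Fin d)) β),
        Filter.Tendsto
          (fun α : ℝ => MeasureTheory.eLpNorm
            (BandInterp.interpolant (BandInterp.gaussian α) x f - f) 2 MeasureTheory.volume)
          Filter.atTop (nhds 0) ∧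
        TendstoUniformly (fun α : ℝ => BandInterp.interpolant (BandInterp.gaussian α) x f) f
          Filter.atTop) ∧
      -- the rate
      ∃ C : ℝ, 0 < C ∧
        ∀ f ∈ BandInterp.paleyWiener (Metric.closedBall (0 : EuclideanSpace ℝ (Fin d)) β),
          ∀ α : ℝ, 1 ≤ α →
            max
              (MeasureTheory.eLpNorm (BandInterp.interpolant (BandInterp.gaussian α) x f - f) 2
                MeasureTheory.volume)
              (MeasureTheory.eLpNorm (BandInterp.interpolant (BandInterp.gaussian α) x f - f) ⊤
                MeasureTheory.volume) ≤
            ENNReal.ofReal (C * Real.exp (α * (β ^ 2 + 2 - 3 * δ ^ 2))) *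
              MeasureTheory.eLpNorm f 2 MeasureTheory.volume := by
  obtain ⟨hδ2, hδ1⟩ := hδ
  obtain ⟨hβ0, hβ1⟩ := hβ
  have hδ0 : 0 < δ := (Real.sqrt_nonneg _).trans_lt hδ2
  have hk : β ^ 2 + 2 - 3 * δ ^ 2 < 0 := by
    have := (Real.lt_sqrt hβ0.le).1 hβ1
    linarith
  have hδsq : δ ^ 2 ≤ 1 := pow_le_one₀ hδ0.le hδ1.le
  -- Here `β² < 3δ² - 2 ≤ δ²`, because `δ² ≤ 1`.
  have hβδ : β ≤ δ := by
    refine le_of_lt (lt_of_pow_lt_pow_left₀ 2 hδ0.le ?_)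
    linarith
  have hZm : MeasurableSet Z := hZ.isCompact.isClosed.measurableSet
  refine ⟨BandInterp.isRegularFamily_gaussian hd hδ0 hδ1 hk hδZ hZ1, fun x hx => ?_⟩
  obtain ⟨C, hC, hCb⟩ :=
    BandInterp.exists_interpolation_error_le hδ0 hδ1.le hβδ hZm hδZ hZ1 hx
  -- The bound proved has the smaller exponent: `-δ² ≤ 2 - 3δ²` is again `δ² ≤ 1`.
  have hrate : ∀ α : ℝ, 1 ≤ α → ENNReal.ofReal (C * Real.exp (α * (β ^ 2 - δ ^ 2))) ≤
      ENNReal.ofReal (C * Real.exp (α * (β ^ 2 + 2 - 3 * δ ^ 2))) := by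
    intro α hα
    refine ENNReal.ofReal_le_ofReal ?_
    have : α * (β ^ 2 - δ ^ 2) ≤ α * (β ^ 2 + 2 - 3 * δ ^ 2) :=
      mul_le_mul_of_nonneg_left (by linarith) (by linarith)
    gcongr
  have hlim : ∀ f ∈ BandInterp.paleyWiener (Metric.closedBall (0 : EuclideanSpace ℝ (Fin d)) β),
      Tendsto (fun α : ℝ => ENNReal.ofReal (C * Real.exp (α * (β ^ 2 - δ ^ 2))) *
        eLpNorm f 2 volume) atTop (𝓝 0) := by
    intro f hf
    have h := ENNReal.Tendsto.mul_const
      (BandInterp.tendsto_ofReal_exp_mul (k := β ^ 2 - δ ^ 2) (by linarith) C)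
      (Or.inr hf.2.choose.2.ne)
    rwa [zero_mul] at h
  refine ⟨fun α hα f hf => BandInterp.interpolation_wellDefined hδ0 hδ1.le hZm hδZ hZ1 hx hα hf,
    fun f hf => ⟨?_, ?_⟩, C, hC, fun f hf α hα => max_le ?_ ?_⟩
  · refine tendsto_of_tendsto_of_tendsto_of_le_of_le' tendsto_const_nhds (hlim f hf)
      (Eventually.of_forall fun _ => zero_le) ?_
    filter_upwards [eventually_ge_atTop 1] with α hα using (hCb f hf α hα).1
  · rw [EMetric.tendstoUniformly_iff]
    intro ε hε
    filter_upwards [eventually_ge_atTop 1, (hlim f hf).eventually (gt_mem_nhds hε)] with α hα h t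
    rw [edist_comm, edist_eq_enorm_sub]
    exact ((hCb f hf α hα).2 t).trans_lt h
  · exact (hCb f hf α hα).1.trans (mul_le_mul_left (hrate α hα) _)
  · rw [eLpNorm_exponent_top]
    refine (essSup_le_of_ae_le _ (Eventually.of_forall fun t => ?_)).trans
      (mul_le_mul_left (hrate α hα) _)
    exact (hCb f hf α hα).2 t
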